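/- Let $N\ge 1$ and consider $N+1$ qubits: ports $A=A_1\cdots A_N$ and an input qubit $A_{N+1}$. For a set $a$ of qubits let $\vec S_a=\frac12\sum_{i\in a}(\sigma_x^{(i)},\sigma_y^{(i)},\sigma_z^{(i)})$, $S_a^2=\vec S_a\cdot\vec S_a$, $Z_a=\frac12\sum_{i\in a}\sigma^{(i)}_z$, and let $\mathbb I(j)_a$ be the orthogonal projector onto the eigenspace of $S_a^2$ with eigenvalue $j(j+1)$ (total spin $j$). Put $$h(N)=\tfrac{6}{(N+1)(N+2)(N+3)},\quad g^{[n]}(j)=\tfrac{(2j+1)\,n!}{(\frac n2-j)!\,(\frac n2+1+j)!},\quad \nu(j)=\tfrac{2^Nh(N)(2j+1)}{g^{[N]}(j)},\quad u(s)=\tfrac{2^{N+1}h(N)(2s+1)}{N\,g^{[N-1]}(s)},$$ where $j$ runs over $\{\frac N2,\frac N2-1,\dots\}\cap[0,\infty)$ and $s$ over $\{\frac{N-1}2,\frac{N-1}2-1,\dots\}\cap[0,\infty)$, and let $O_A=\sum_j\sqrt{\nu(j)}\,\mathbb I(j)_A$ (which is invertible), $\tilde\Theta_{i}=\sum_s u(s)\,\mathbb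 I(s)_{\bar A_i}$ with $\bar A_i=A\setminus A_i$. With $|\psi^-\rangle=(|01\rangle-|10\rangle)/\sqrt2$, the optimal POVM of probabilistic port-based teleportation with optimised resource state is $$\Pi_i=(O_A^{-1}\otimes I_{A_{N+1}})\big(|\psi^-\rangle\langle\psi^-|_{A_iA_{N+1}}\otimes\tilde\Theta_{i}\big)(O_A^{-1}\otimes I_{A_{N+1}})\ (1\le i\le N),\qquad \Pi_{N+1}=I-\sum_{i=1}^N\Pi_i .$$ Let $|k,j,s,m\rangle$ be the Schur states of the $N+1$ qubits, obtained by coupling the qubits $A_1,A_2,\dots,A_{N+1}$ one after the other with the Clebsch–Gordan coefficients (Condon–Shortley convention, $|0\rangle=|m=\frac12\rangle$, $|1\rangle=|m=-\frac12\rangle$): $k=(\tilde k,k_{N-2})$ lists the total spins of the initial segments of at most $N-1$ qubits, $k_{N-2}$ being that of $A_1\cdots A_{N-1}$ (it is $0$ if $N=1$ and $\frac12$ if $N=2$), $j$ is the spin of $A$, $s$ that of all $N+1$ qubits, consecutive spins are non-negative and differ by $\frac12$, and $m\in\{-s,\dots,s\}$ is the total $Z$-spin. Put $$\gamma(s)=\sqrt{\tfrac{s}{(2s+1)\,\nu(s-\frac12)}}\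 \ (\gamma(0)=0),\qquad \delta(s)=-\sqrt{\tfrac{s+1}{(2s+1)\,\nu(s+\frac12)}},\qquad \lambda(j,s)=\begin{cases}2^{-N}(\frac N2-j)& s=j+\frac12,\\ 2^{-N}(\frac N2+j+1)& s=j-\frac12.\end{cases}$$ Then the Schur states form an orthonormal basis of simultaneous eigenvectors of $S^2_{A_1\cdots A_i}$ ($1\le i\le N+1$) and $Z_{A_1\cdots A_{N+1}}$, with the eigenvalues indicated by their labels, and the following hold. 1. $\Pi_N$ has the following eigenvectors, which together span the space: every $|k,j,s,m\rangle$ with $k_{N-2}\ne s$, with eigenvalue $0$; and for all $\tilde k,m$ and all $s>0$ with $k_{N-2}=s$, $$\tfrac{\delta(s)|\tilde k,s,s-\frac12,s,m\rangle-\gamma(s)|\tilde k,s,s+\frac12,s,m\rangle}{\sqrt{\gamma(s)^2+\delta(s)^2}}\text{ with eigenvalue }0,\qquad \tfrac{\gamma(s)|\tilde k,s,s-\frac12,s,m\rangle+\delta(s)|\tilde k,s,s+\frac12,s,m\rangle}{\sqrt{\gamma(s)^2+\delta(s)^2}}\text{ with eigenvalue }u(s)\big(\gamma(s)^2+\delta(s)^2\big)>0;$$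 for $k_{N-2}=s=0$, where only $j=\frac12$ is possible, $|\tilde k,0,\frac12,0,0\rangle$ has eigenvalue $u(0)(\gamma(0)^2+\delta(0)^2)>0$. 2. For $1\le i\le N$, $\Pi_i=\mathrm{SWAP}_{A_iA_N}\,\Pi_N\,\mathrm{SWAP}_{A_iA_N}$, so $v$ is an eigenvector of $\Pi_N$ exactly when $\mathrm{SWAP}_{A_iA_N}v$ is an eigenvector of $\Pi_i$ with the same eigenvalue. 3. $\Pi_{N+1}$ is diagonal in the Schur basis: $|k,j,s,m\rangle$ has eigenvalue $1-\dfrac{2^{N-1}\lambda(j,s)\,u(s)}{\nu(j)}$ if $s\le\frac{N-1}2$, and eigenvalue $1$ if $s=\frac{N+1}2$ (where $\lambda(j,s)=0$ and $u(s)$ is not defined). -/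

import Mathlib

noncomputable section

namespace PBT

/-! ### Qubits, angular momentum, total spin

Half-integers (spins and `Z`-spins) are stored as their doubles throughout: the natural number `d`
stands for the spin `d / 2`, the integer `z` for the `Z`-spin `z / 2`. -/

/-- The Hilbert space of `n` qubits, with computational basis the bit strings `Fin n → Fin 2`. -/
abbrev QState (n : ℕ) : Type := EuclideanSpace ℂ (Fin n → Fin 2)

/-- Linear operators on `n` qubits. -/
abbrev QOp (n : ℕ) : Type := Module.End ℂ (QState n)

/-- The `2 × 2` matrix `M` acting on qubit `i`, identity on the other qubits. -/
def qubitOp {n : ℕ} (M : Matrix (Fin 2) (Fin 2) ℂ) (i : Fin n) : QOp n :=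
  Matrix.toEuclideanLin
    (Matrix.of fun x y : Fin n → Fin 2 => if ∀ l, l ≠ i → x l = y l then M (x i) (y i) else 0)

/-- The Pauli matrices `σ_x, σ_y, σ_z`. -/
def pauli : Fin 3 → Matrix (Fin 2) (Fin 2) ℂ :=
  ![!![0, 1; 1, 0], !![0, -Complex.I; Complex.I, 0], !![1, 0; 0, -1]]

/-- The component along the axis `c` of the angular momentum of the qubits in `a`. -/
def spinOp {n : ℕ} (a : Finset (Fin n)) (c : Fin 3) : QOp n :=
  ∑ i ∈ a, (1 / 2 : ℂ) • qubitOp (pauli c) i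

/-- The total angular momentum operator `S²_a`. -/
def totalSpin {n : ℕ} (a : Finset (Fin n)) : QOp n := ∑ c : Fin 3, spinOp a c * spinOp a c

/-- The `Z`-angular momentum operator `Z_a`. -/
def zSpin {n : ℕ} (a : Finset (Fin n)) : QOp n := spinOp a 2

/-- The projector `𝕀(j)_a`, `j = d / 2`, as an operator on all `n` qubits: the orthogonal projector
onto the states in which the qubits in `a` have total spin `j`, that is, onto the eigenspace of
`S²_a` for the eigenvalue `j (j + 1)`. -/
def spinProj {n : ℕ} (a : Finset (Fin n)) (d : ℕ) : QOp n :=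
  ((Module.End.eigenspace (totalSpin a)
    ((d : ℂ) / 2 * ((d : ℂ) / 2 + 1))).starProjection : QState n →ₗ[ℂ] QState n)

/-- The (doubled) total spins possible for `n` qubits: `n, n - 2, …` down to `0` or `1`. -/
def spins (n : ℕ) : Finset ℕ := (Finset.range (n + 1)).filter fun d => d % 2 = n % 2

/-! ### Schur states -/

/-- Labels of the Schur states on `n` qubits: `spin i` is twice the total spin of the first `i`
qubits (so `0` for `i = 0`, hence `1` for `i = 1`), consecutive spins differing by `1/2`, and `z` is
twice the total `Z`-spin `m ∈ {-j, -j + 1, …, j}`, where `j` is the spin of all the qubits. -/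
structure SchurLabel (n : ℕ) where
  spin : Fin (n + 1) → ℕ
  spin_zero : spin 0 = 0
  spin_step : ∀ i : Fin n,
    spin i.succ = spin i.castSucc + 1 ∨ spin i.castSucc = spin i.succ + 1
  z : ℤ
  abs_z_le : |z| ≤ (spin (Fin.last n) : ℤ)
  even_z : Even (z + (spin (Fin.last n) : ℤ))

/-- Twice the `Z`-spin of a computational basis state of a qubit: `|0⟩ = |1/2⟩`, `|1⟩ = |-1/2⟩`. -/
def zBit (b : Fin 2) : ℤ := if b = 0 then 1 else -1

/-- The Clebsch-Gordan coefficient `C^{J, M}_{j, M - x; 1/2, x}` in the Condon-Shortley convention,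
where `d, D, z` are twice `j, J, M` and the bit `b` encodes `x = ± 1/2`. -/
def cgHalf (d D : ℕ) (z : ℤ) (b : Fin 2) : ℝ :=
  if D = d + 1 then
    if b = 0 then √(1 / 2 * (1 + (z : ℝ) / ((d : ℝ) + 1)))
    else √(1 / 2 * (1 - (z : ℝ) / ((d : ℝ) + 1)))
  else if d = D + 1 then
    if b = 0 then -√(1 / 2 * (1 - (z : ℝ) / ((d : ℝ) + 1)))
    else √(1 / 2 * (1 + (z : ℝ) / ((d : ℝ) + 1)))
  else 0

/-- The Schur state with label `ℓ`, obtained by coupling the qubits one after the other: the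
amplitude at `|x₁ … xₙ⟩` is the product of the coefficients
`C^{k_i, x₁ + ⋯ + x_i}_{k_{i-1}, x₁ + ⋯ + x_{i-1}; 1/2, x_i}`, with `k_i` the spin of the first `i`
qubits, if `x₁ + ⋯ + xₙ = m`, and `0` otherwise. (The factor at the first `i` at which
`|x₁ + ⋯ + x_i| ≤ k_i` fails, if there is one, is `0`.) -/
def schurState {n : ℕ} (ℓ : SchurLabel n) : QState n :=
  WithLp.toLp 2 fun x : Fin n → Fin 2 =>
    if ∑ l, zBit (x l) = ℓ.z then
      ((∏ i : Fin n, cgHalf (ℓ.spin i.castSucc) (ℓ.spin i.succ)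
        (∑ l ∈ Finset.Iic i, zBit (x l)) (x i) : ℝ) : ℂ)
    else 0

/-- For a Schur state on `N + 1` qubits, (twice) the spin of the first `N - 1` qubits. -/
def SchurLabel.kSpin {N : ℕ} (ℓ : SchurLabel (N + 1)) : ℕ := ℓ.spin ⟨N - 1, by omega⟩

/-- For a Schur state on `N + 1` qubits, (twice) the spin of the first `N` qubits. -/
def SchurLabel.jSpin {N : ℕ} (ℓ : SchurLabel (N + 1)) : ℕ := ℓ.spin ⟨N, by omega⟩

/-- For a Schur state on `N + 1` qubits, (twice) the spin of all the qubits. -/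
def SchurLabel.sSpin {N : ℕ} (ℓ : SchurLabel (N + 1)) : ℕ := ℓ.spin (Fin.last (N + 1))

/-! ### Coefficients -/

/-- `h(N) = 6 / ((N + 1) (N + 2) (N + 3))`. -/
def hCoef (N : ℕ) : ℝ := 6 / (((N : ℝ) + 1) * ((N : ℝ) + 2) * ((N : ℝ) + 3))

/-- `g^{[N]}(j) = (2j + 1) N! / ((N/2 - j)! (N/2 + 1 + j)!)`, with `d = 2j ≤ N`, `d ≡ N mod 2`. -/
def gCoef (N d : ℕ) : ℝ :=
  ((d : ℝ) + 1) * (N.factorial : ℝ) /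
    ((((N - d) / 2).factorial : ℝ) * (((N + d) / 2 + 1).factorial : ℝ))

/-- `ν(j) = 2^N h(N) (2j + 1) / g^{[N]}(j)`, with `d = 2j`. -/
def nu (N d : ℕ) : ℝ := 2 ^ N * hCoef N * ((d : ℝ) + 1) / gCoef N d

/-- `u(s) = 2^{N+1} h(N) (2s + 1) / (N g^{[N-1]}(s))`, with `d = 2s`. -/
def uCoef (N d : ℕ) : ℝ := 2 ^ (N + 1) * hCoef N * ((d : ℝ) + 1) / ((N : ℝ) * gCoef (N - 1) d)

/-- `λ(j, s)`, with `j` and `s` given by their doubles. -/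
def lam (N j s : ℕ) : ℝ :=
  if s = j + 1 then 1 / 2 ^ N * ((N : ℝ) / 2 - (j : ℝ) / 2)
  else if j = s + 1 then 1 / 2 ^ N * ((N : ℝ) / 2 + (j : ℝ) / 2 + 1)
  else 0

/-- `c(k, j, s)`, with `k`, `j` and `s` given by their doubles. -/
def cCoef (k j s : ℕ) : ℝ :=
  if s = j + 1 ∧ k = j + 1 then √((s : ℝ) / 2 / ((s : ℝ) + 1))
  else if j = s + 1 ∧ j = k + 1 then -√(((s : ℝ) / 2 + 1) / ((s : ℝ) + 1))
  else 0

/-- `γ(s) = c(s, s - 1/2, s) / √ν(s - 1/2)`, with `d = 2s`; it is `0` for `s = 0`. -/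
def gam (N d : ℕ) : ℝ := cCoef d (d - 1) d / √(nu N (d - 1))

/-- `δ(s) = c(s, s + 1/2, s) / √ν(s + 1/2)`, with `d = 2s`. -/
def del (N d : ℕ) : ℝ := cCoef d (d + 1) d / √(nu N (d + 1))

/-! ### The measurement

Alice holds `N + 1` qubits: the ports `A_1, …, A_N` (indices `i.castSucc`, `i : Fin N`) and the
input `A_{N+1}` (index `Fin.last N`). -/

/-- Amplitudes of the singlet `(|01⟩ - |10⟩) / √2`. -/
def singlet (b b' : Fin 2) : ℂ :=
  if b = 0 ∧ b' = 1 then 1 / (√2 : ℝ) else if b = 1 ∧ b' = 0 then -1 / (√2 : ℝ) else 0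

/-- The projector onto the singlet of the qubits `p` and `q`, identity on the other qubits. -/
def singletProj {n : ℕ} (p q : Fin n) : QOp n :=
  Matrix.toEuclideanLin
    (Matrix.of fun x y : Fin n → Fin 2 =>
      if ∀ l, l ≠ p → l ≠ q → x l = y l then
        singlet (x p) (x q) * (starRingEnd ℂ) (singlet (y p) (y q))
      else 0)

/-- The operator exchanging the qubits `p` and `q`. -/
def swapOp {n : ℕ} (p q : Fin n) : QOp n :=
  Matrix.toEuclideanLin
    (Matrix.of fun x y : Fin n → Fin 2 => if y = x ∘ Equiv.swap p q then (1 : ℂ) else 0)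

/-- The ports `A = A_1 … A_N`. -/
def ports (N : ℕ) : Finset (Fin (N + 1)) := Finset.univ.erase (Fin.last N)

/-- `O_A ⊗ I = ∑_j √ν(j) 𝕀(j)_A ⊗ I`. -/
def opO (N : ℕ) : QOp (N + 1) :=
  ∑ d ∈ spins N, ((√(nu N d) : ℝ) : ℂ) • spinProj (ports N) d

/-- `Θ̃_i = ∑_s u(s) 𝕀(s)` on the ports other than `A_i`, identity on the other two qubits. -/
def opTheta (N : ℕ) (i : Fin N) : QOp (N + 1) :=
  ∑ d ∈ spins (N - 1), ((uCoef N d : ℝ) : ℂ) • spinProj ((ports N).erase i.castSucc) d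

/-- The measurement operator `Π_i` for the success outcome `i`. The tensor product of the singlet
projector and `Θ̃_i`, which act on complementary sets of qubits, is their composition. -/
def povm (N : ℕ) (i : Fin N) : QOp (N + 1) :=
  Ring.inverse (opO N) * (singletProj i.castSucc (Fin.last N) * opTheta N i) *
    Ring.inverse (opO N)

/-- The measurement operator `Π_{N+1}` for failure. -/
def povmFail (N : ℕ) : QOp (N + 1) := 1 - ∑ i : Fin N, povm N i

end PBT

end

open PBT

/-! Let `k`, `j`, `s` be the total spins of the first `n`, `n + 1` and `n + 2` qubits. Adding a
qubit to a state of spin `j` by Clebsch-Gordan coupling produces the spins `j ± 1/2`, so by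
induction the Schur states are an orthonormal basis in which the `S²` of all initial segments are
diagonal. Projecting the last two qubits of a Schur state onto the singlet leaves `0` if `k ≠ s`,
and `c(k, j, k)` times the Schur state of the first `n` qubits if `k = s`. Hence the singlet
projector on these two qubits mixes only the Schur states with `j = s ± 1/2` for one `s = k`, by the
rank one matrix `c(s, j, s) c(s, j', s)`. Multiplying by `O_A⁻¹` and `Θ̃_N`, scalar on each Schur
state, gives `Π_N`; the other `Π_i` are conjugate to it, since `O_A` is invariant under
exchanging ports.

For `Π_{N+1}`, a singlet on `A_i` and `A_{N+1}` carries no spin, so behind the projector onto it the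
spin of the other ports is that of all `N + 1` qubits, and every `Θ̃_i` may be replaced by the same
operator `∑_s u(s) 𝕀(s)`. What remains is the sum of the singlet projectors
`1/4 - S_{A_i} · S_{A_{N+1}}`, which is a combination of `S²_A` and the `S²` of all the qubits,
because `2 S_a · S_b = S²_{a ∪ b} - S²_a - S²_b` for disjoint `a` and `b`. -/

noncomputable section

namespace PBT

variable {n : ℕ}

/-! ### Operators on one and two qubits -/

section Agreement

variable {α β M : Type*} [Fintype α] [DecidableEq α] [Fintype β] [AddCommMonoid M]

theorem sum_ite_forall_ne_eq (i : α) (x : α → β) (f : (α → β) → M)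
    [DecidablePred fun y : α → β => ∀ l, l ≠ i → x l = y l] :
    ∑ y : α → β, (if ∀ l, l ≠ i → x l = y l then f y else 0) = ∑ b, f (Function.update x i b) := by
  have image_update : Finset.univ.filter (fun y : α → β => ∀ l, l ≠ i → x l = y l) =
      Finset.univ.map ⟨Function.update x i, Function.update_injective x i⟩ := by
    ext y
    simp only [Finset.mem_filter, Finset.mem_univ, true_and, Finset.mem_map,
      Function.Embedding.coeFn_mk, Function.update_eq_iff]
    exact ⟨fun h => ⟨y i, rfl, h⟩, fun ⟨_, _, h⟩ => h⟩
  rw [← Finset.sum_filter, image_update, Finset.sum_map]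
  rfl

theorem sum_ite_forall_ne_ne_eq {p q : α} (hpq : p ≠ q) (x : α → β) (f : (α → β) → M)
    [DecidablePred fun y : α → β => ∀ l, l ≠ p → l ≠ q → x l = y l] :
    ∑ y : α → β, (if ∀ l, l ≠ p → l ≠ q → x l = y l then f y else 0) =
      ∑ a, ∑ b, f (Function.update (Function.update x p a) q b) := by
  classical
  simp_rw [← sum_ite_forall_ne_eq q]
  rw [Finset.sum_comm]
  refine Finset.sum_congr rfl fun y _ => ?_
  have agree_iff (a : β) : (∀ l, l ≠ q → Function.update x p a l = y l) ↔
      a = y p ∧ ∀ l, l ≠ p → l ≠ q → x l = y l := by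
    grind [Function.update_apply]
  simp_rw [agree_iff, ite_and]
  rw [Finset.sum_ite_eq' Finset.univ (y p), if_pos (Finset.mem_univ _)]

end Agreement

theorem toEuclideanLin_apply_apply {ι : Type*} [Fintype ι] [DecidableEq ι] (A : Matrix ι ι ℂ)
    (v : EuclideanSpace ℂ ι) (x : ι) : Matrix.toEuclideanLin A v x = ∑ y, A x y * v y :=
  rfl

theorem qubitOp_apply (M : Matrix (Fin 2) (Fin 2) ℂ) (i : Fin n) (v : QState n)
    (x : Fin n → Fin 2) :
    qubitOp M i v x = ∑ b, M (x i) b * v (Function.update x i b) := by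
  simp only [qubitOp, toEuclideanLin_apply_apply, Matrix.of_apply, ite_mul, zero_mul,
    sum_ite_forall_ne_eq i x, Function.update_self]

theorem singletProj_apply {p q : Fin n} (hpq : p ≠ q) (v : QState n) (x : Fin n → Fin 2) :
    singletProj p q v x = singlet (x p) (x q) *
      (((√2 : ℝ) : ℂ)⁻¹ * (v (Function.update (Function.update x p 0) q 1) -
        v (Function.update (Function.update x p 1) q 0))) := by
  simp only [singletProj, toEuclideanLin_apply_apply, Matrix.of_apply, ite_mul, zero_mul,
    sum_ite_forall_ne_ne_eq hpq x]
  simp [Fin.sum_univ_two, hpq, singlet]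
  ring_nf

theorem swapOp_apply (p q : Fin n) (v : QState n) (x : Fin n → Fin 2) :
    swapOp p q v x = v (x ∘ Equiv.swap p q) := by
  simp [swapOp, toEuclideanLin_apply_apply]

theorem qubitOp_one (i : Fin n) : qubitOp 1 i = 1 := by
  ext v x
  simp [qubitOp_apply, Matrix.one_apply]

theorem qubitOp_mul (M M' : Matrix (Fin 2) (Fin 2) ℂ) (i : Fin n) :
    qubitOp (M * M') i = qubitOp M i * qubitOp M' i := by
  ext v x
  simp only [Module.End.mul_apply, qubitOp_apply, Function.update_self, Function.update_idem,
    Matrix.mul_apply, Finset.sum_mul, Finset.mul_sum, mul_assoc]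
  rw [Finset.sum_comm]

theorem commute_qubitOp {i j : Fin n} (hij : i ≠ j) (M M' : Matrix (Fin 2) (Fin 2) ℂ) :
    Commute (qubitOp M i) (qubitOp M' j) := by
  ext v x
  simp only [Module.End.mul_apply, qubitOp_apply, Function.update_of_ne hij,
    Function.update_of_ne hij.symm, Finset.mul_sum]
  rw [Finset.sum_comm]
  simp only [Function.update_comm hij, mul_left_comm]

theorem qubitOp_isSymmetric {M : Matrix (Fin 2) (Fin 2) ℂ} (hM : M.IsHermitian) (i : Fin n) :
    (qubitOp M i).IsSymmetric := by
  refine Matrix.isSymmetric_toEuclideanLin_iff.mpr (Matrix.IsHermitian.ext fun x y => ?_)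
  simp only [Matrix.of_apply, apply_ite star, star_zero, hM.apply]
  grind

theorem pauli_isHermitian (c : Fin 3) : (pauli c).IsHermitian := by
  fin_cases c <;> ext i j <;> fin_cases i <;> fin_cases j <;> simp [pauli]

theorem pauli_mul_self (c : Fin 3) : pauli c * pauli c = 1 := by
  fin_cases c <;> simp [pauli, Matrix.one_fin_two]

theorem qubitOp_pauli_mul_self (c : Fin 3) (i : Fin n) :
    qubitOp (pauli c) i * qubitOp (pauli c) i = 1 := by
  rw [← qubitOp_mul, pauli_mul_self, qubitOp_one]

theorem singletProj_eq {p q : Fin n} (hpq : p ≠ q) :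
    singletProj p q = (1 / 4 : ℂ) • (1 : QOp n) -
      (1 / 4 : ℂ) • ∑ c, qubitOp (pauli c) p * qubitOp (pauli c) q := by
  ext v x
  have half : ((√2 : ℝ) : ℂ)⁻¹ * ((√2 : ℝ) : ℂ)⁻¹ = 1 / 2 := by
    rw [← mul_inv, ← Complex.ofReal_mul, Real.mul_self_sqrt zero_le_two, Complex.ofReal_ofNat,
      one_div]
  have eq_update : v x = v (Function.update (Function.update x p (x p)) q (x q)) := by simp
  rw [singletProj_apply hpq]
  simp only [LinearMap.sub_apply, LinearMap.smul_apply, Module.End.one_apply, LinearMap.add_apply,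
    Fin.sum_univ_three, Module.End.mul_apply, PiLp.sub_apply, PiLp.smul_apply, PiLp.add_apply,
    qubitOp_apply, Fin.sum_univ_two, Function.update_of_ne hpq.symm, smul_eq_mul, eq_update]
  generalize x p = b
  generalize x q = b'
  fin_cases b <;> fin_cases b' <;>
    simp [pauli, singlet, div_eq_mul_inv, ← mul_assoc, half] <;> ring_nf

/-! ### Angular momenta -/

theorem spinOp_isSymmetric (a : Finset (Fin n)) (c : Fin 3) : (spinOp a c).IsSymmetric :=
  LinearMap.isSymmetric_sum _ fun i _ =>
    (qubitOp_isSymmetric (pauli_isHermitian c) i).smul (by simp [Complex.conj_ofNat])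

theorem totalSpin_isSymmetric (a : Finset (Fin n)) : (totalSpin a).IsSymmetric :=
  LinearMap.isSymmetric_sum _ fun c _ =>
    (spinOp_isSymmetric a c).mul_of_commute (spinOp_isSymmetric a c) (Commute.refl _)

theorem spin_eigenvalue_injective :
    Function.Injective fun d : ℕ => (d : ℂ) / 2 * ((d : ℂ) / 2 + 1) := by
  intro d e h
  have eq_nat : d * (d + 2) = e * (e + 2) := by
    have : (d : ℂ) * (d + 2) = e * (e + 2) := by linear_combination 4 * h
    exact_mod_cast this
  rcases lt_trichotomy d e with hlt | heq | hgt
  · nlinarith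
  · exact heq
  · nlinarith

theorem spinProj_apply_of_totalSpin {a : Finset (Fin n)} {e : ℕ} {v : QState n}
    (hv : totalSpin a v = ((e : ℂ) / 2 * ((e : ℂ) / 2 + 1)) • v) (d : ℕ) :
    spinProj a d v = if d = e then v else 0 := by
  rw [spinProj, ContinuousLinearMap.coe_coe]
  split_ifs with hde
  · rwa [Submodule.starProjection_eq_self_iff, Module.End.mem_eigenspace_iff, hde]
  · rw [Submodule.starProjection_apply_eq_zero_iff]
    exact fun w hw => (totalSpin_isSymmetric a).orthogonalFamily_eigenspaces
      (spin_eigenvalue_injective.ne hde) ⟨w, hw⟩ ⟨v, Module.End.mem_eigenspace_iff.mpr hv⟩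

theorem sum_smul_spinProj_apply {a : Finset (Fin n)} {e : ℕ} {v : QState n}
    (hv : totalSpin a v = ((e : ℂ) / 2 * ((e : ℂ) / 2 + 1)) • v) (D : Finset ℕ) (f : ℕ → ℂ) :
    (∑ d ∈ D, f d • spinProj a d) v = if e ∈ D then f e • v else 0 := by
  simp [LinearMap.sum_apply, spinProj_apply_of_totalSpin hv]

theorem spinOp_insert {p : Fin n} {a : Finset (Fin n)} (hp : p ∉ a) (c : Fin 3) :
    spinOp (insert p a) c = (1 / 2 : ℂ) • qubitOp (pauli c) p + spinOp a c :=
  Finset.sum_insert hp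

theorem sum_qubitOp_pauli_mul {p : Fin n} {a : Finset (Fin n)} (hp : p ∉ a) (c : Fin 3) :
    ∑ i ∈ a, qubitOp (pauli c) i * qubitOp (pauli c) p =
      (2 : ℂ) • (spinOp (insert p a) c * spinOp (insert p a) c - spinOp a c * spinOp a c) -
        (1 / 2 : ℂ) • (1 : QOp n) := by
  have sum_eq : ∑ i ∈ a, qubitOp (pauli c) i * qubitOp (pauli c) p =
      (2 : ℂ) • (spinOp a c * qubitOp (pauli c) p) := by
    simp [spinOp, Finset.sum_mul, Finset.smul_sum, smul_smul]
  have commute : Commute (qubitOp (pauli c) p) (spinOp a c) :=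
    .sum_right _ _ _ fun i hi =>
      (commute_qubitOp (ne_of_mem_of_not_mem hi hp).symm _ _).smul_right _
  rw [sum_eq, spinOp_insert hp, add_mul, mul_add, mul_add, smul_mul_smul_comm,
    qubitOp_pauli_mul_self, smul_mul_assoc, mul_smul_comm, commute.eq]
  module

theorem sum_singletProj {p : Fin n} {a : Finset (Fin n)} (hp : p ∉ a) :
    ∑ i ∈ a, singletProj i p = ((a.card : ℂ) / 4 + 3 / 8) • (1 : QOp n) -
      (1 / 2 : ℂ) • (totalSpin (insert p a) - totalSpin a) := by
  have sum_eq : ∑ i ∈ a, singletProj i p = ((a.card : ℂ) / 4) • (1 : QOp n) -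
      (1 / 4 : ℂ) • ∑ c, ∑ i ∈ a, qubitOp (pauli c) i * qubitOp (pauli c) p := by
    rw [Finset.sum_congr rfl fun i hi => singletProj_eq (ne_of_mem_of_not_mem hi hp),
      Finset.sum_sub_distrib, Finset.sum_const, ← Finset.smul_sum, Finset.sum_comm,
      ← Nat.cast_smul_eq_nsmul ℂ, smul_smul, mul_one_div]
  simp only [sum_eq, sum_qubitOp_pauli_mul hp, totalSpin, Fin.sum_univ_three]
  module

theorem ports_eq_map (N : ℕ) : ports N = Finset.univ.map Fin.castSuccEmb := by
  simp [ports, Fin.univ_castSuccEmb]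

theorem sum_singletProj_ports (N : ℕ) :
    ∑ i : Fin N, singletProj i.castSucc (Fin.last N) =
      ((N : ℂ) / 4 + 3 / 8) • (1 : QOp (N + 1)) -
        (1 / 2 : ℂ) • (totalSpin Finset.univ - totalSpin (ports N)) := by
  have sum_ports := sum_singletProj (Finset.notMem_erase (Fin.last N) Finset.univ)
  rw [Finset.insert_erase (Finset.mem_univ _), ← ports, ports_eq_map, Finset.sum_map,
    Finset.card_map, Finset.card_fin, ← ports_eq_map] at sum_ports
  exact sum_ports

/-! ### Exchanging two qubits -/

theorem semiconjBy_sum_right {ι R : Type*} [NonUnitalNonAssocSemiring R] {s : Finset ι} {w : R}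
    {x y : ι → R} (h : ∀ i ∈ s, SemiconjBy w (x i) (y i)) :
    SemiconjBy w (∑ i ∈ s, x i) (∑ i ∈ s, y i) := by
  rw [SemiconjBy, Finset.mul_sum, Finset.sum_mul]
  exact Finset.sum_congr rfl h

theorem eigenspace_eq_map {K E F : Type*} [CommRing K] [AddCommGroup E] [AddCommGroup F]
    [Module K E] [Module K F] (W : E ≃ₗ[K] F) {T : Module.End K E} {T' : Module.End K F}
    (h : ∀ v, W (T v) = T' (W v)) (μ : K) :
    T'.eigenspace μ = (T.eigenspace μ).map (W : E →ₗ[K] F) := by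
  ext v
  rw [Submodule.mem_map_equiv, Module.End.mem_eigenspace_iff, Module.End.mem_eigenspace_iff,
    ← W.injective.eq_iff, h, map_smul, W.apply_symm_apply]

/-- The exchange of the qubits `p` and `q` as a unitary. -/
def swapIso (p q : Fin n) : QState n ≃ₗᵢ[ℂ] QState n :=
  LinearIsometryEquiv.piLpCongrLeft 2 ℂ ℂ (Equiv.arrowCongr (Equiv.swap p q) (Equiv.refl (Fin 2)))

theorem swapIso_apply (p q : Fin n) (v : QState n) : swapIso p q v = swapOp p q v := by
  ext x
  rw [swapOp_apply, swapIso, LinearIsometryEquiv.piLpCongrLeft_apply]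
  rfl

theorem swapOp_mul_self (p q : Fin n) : swapOp p q * swapOp p q = 1 := by
  ext v x
  simp [swapOp_apply, Function.comp_assoc, ← Equiv.coe_trans]

theorem ringInverse_swapOp (p q : Fin n) : Ring.inverse (swapOp p q) = swapOp p q :=
  Ring.inverse_unit ⟨swapOp p q, swapOp p q, swapOp_mul_self p q, swapOp_mul_self p q⟩

theorem semiconjBy_swapOp_qubitOp (p q : Fin n) (M : Matrix (Fin 2) (Fin 2) ℂ) (i : Fin n) :
    SemiconjBy (swapOp p q) (qubitOp M i) (qubitOp M (Equiv.swap p q i)) := by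
  ext v x
  simp only [Module.End.mul_apply, swapOp_apply, qubitOp_apply, Function.update_comp_equiv,
    Function.comp_apply, Equiv.symm_swap, Equiv.swap_apply_self]

theorem semiconjBy_swapOp_spinOp (p q : Fin n) (a : Finset (Fin n)) (c : Fin 3) :
    SemiconjBy (swapOp p q) (spinOp a c) (spinOp (a.map (Equiv.swap p q).toEmbedding) c) := by
  rw [spinOp, spinOp, Finset.sum_map]
  exact semiconjBy_sum_right fun i _ => (semiconjBy_swapOp_qubitOp p q _ i).smul_right _

theorem semiconjBy_swapOp_totalSpin (p q : Fin n) (a : Finset (Fin n)) :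
    SemiconjBy (swapOp p q) (totalSpin a) (totalSpin (a.map (Equiv.swap p q).toEmbedding)) :=
  semiconjBy_sum_right fun c _ =>
    (semiconjBy_swapOp_spinOp p q a c).mul_right (semiconjBy_swapOp_spinOp p q a c)

theorem semiconjBy_swapOp_spinProj (p q : Fin n) (a : Finset (Fin n)) (d : ℕ) :
    SemiconjBy (swapOp p q) (spinProj a d) (spinProj (a.map (Equiv.swap p q).toEmbedding) d) := by
  have intertwines (v : QState n) : swapIso p q (totalSpin a v) =
      totalSpin (a.map (Equiv.swap p q).toEmbedding) (swapIso p q v) := by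
    rw [swapIso_apply, swapIso_apply]
    exact LinearMap.congr_fun (semiconjBy_swapOp_totalSpin p q a).eq v
  ext1 v
  simp only [Module.End.mul_apply, spinProj, ContinuousLinearMap.coe_coe, ← swapIso_apply,
    eigenspace_eq_map (swapIso p q).toLinearEquiv intertwines,
    Submodule.starProjection_map_apply, LinearIsometryEquiv.symm_apply_apply]

theorem semiconjBy_swapOp_sum_smul_spinProj (p q : Fin n) (a : Finset (Fin n)) (D : Finset ℕ)
    (f : ℕ → ℂ) :
    SemiconjBy (swapOp p q) (∑ d ∈ D, f d • spinProj a d)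
      (∑ d ∈ D, f d • spinProj (a.map (Equiv.swap p q).toEmbedding) d) :=
  semiconjBy_sum_right fun d _ => (semiconjBy_swapOp_spinProj p q a d).smul_right _

theorem semiconjBy_swapOp_singletProj (p q : Fin n) {i j : Fin n} (hij : i ≠ j) :
    SemiconjBy (swapOp p q) (singletProj i j)
      (singletProj (Equiv.swap p q i) (Equiv.swap p q j)) := by
  rw [singletProj_eq hij, singletProj_eq ((Equiv.swap p q).injective.ne hij)]
  exact ((SemiconjBy.one_right _).smul_right _).sub_right <|
    (semiconjBy_sum_right fun c _ => (semiconjBy_swapOp_qubitOp p q _ i).mul_right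
      (semiconjBy_swapOp_qubitOp p q _ j)).smul_right _

section Ports

variable {N : ℕ} (i j : Fin N)

theorem swap_castSucc_last :
    Equiv.swap i.castSucc j.castSucc (Fin.last N) = Fin.last N :=
  Equiv.swap_apply_of_ne_of_ne (Fin.castSucc_lt_last i).ne' (Fin.castSucc_lt_last j).ne'

theorem map_swap_ports :
    (ports N).map (Equiv.swap i.castSucc j.castSucc).toEmbedding = ports N := by
  rw [ports, Finset.map_erase, Finset.map_univ_equiv, Equiv.toEmbedding_apply, swap_castSucc_last]

theorem semiconjBy_swapOp_opTheta :
    SemiconjBy (swapOp i.castSucc j.castSucc) (opTheta N j) (opTheta N i) := by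
  have map_swap_erase : ((ports N).erase j.castSucc).map
      (Equiv.swap i.castSucc j.castSucc).toEmbedding = (ports N).erase i.castSucc := by
    rw [Finset.map_erase, map_swap_ports, Equiv.toEmbedding_apply, Equiv.swap_apply_right]
  rw [opTheta, opTheta, ← map_swap_erase]
  exact semiconjBy_swapOp_sum_smul_spinProj _ _ _ _ _

theorem semiconjBy_swapOp_singletProj_last :
    SemiconjBy (swapOp i.castSucc j.castSucc) (singletProj j.castSucc (Fin.last N))
      (singletProj i.castSucc (Fin.last N)) := by
  simpa only [Equiv.swap_apply_right, swap_castSucc_last] using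
    semiconjBy_swapOp_singletProj i.castSucc j.castSucc (Fin.castSucc_lt_last j).ne

theorem commute_swapOp_ringInverse_opO :
    Commute (swapOp i.castSucc j.castSucc) (Ring.inverse (opO N)) := by
  have commute_opO : Commute (swapOp i.castSucc j.castSucc) (opO N) := by
    have semiconj := semiconjBy_swapOp_sum_smul_spinProj i.castSucc j.castSucc (ports N) (spins N)
      fun d => ((√(nu N d) : ℝ) : ℂ)
    rwa [map_swap_ports] at semiconj
  simpa only [ringInverse_swapOp] using commute_opO.ringInverse_ringInverse

theorem semiconjBy_swapOp_povm :
    SemiconjBy (swapOp i.castSucc j.castSucc) (povm N j) (povm N i) := by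
  have commute_inverse := commute_swapOp_ringInverse_opO i j
  rw [povm, povm]
  refine .mul_right (.mul_right commute_inverse.semiconjBy (.mul_right ?_ ?_))
    commute_inverse.semiconjBy
  · exact semiconjBy_swapOp_singletProj_last i j
  · exact semiconjBy_swapOp_opTheta i j

theorem povm_eq_swapOp_conj :
    povm N i = swapOp i.castSucc j.castSucc * povm N j * swapOp i.castSucc j.castSucc := by
  rw [(semiconjBy_swapOp_povm i j).eq, mul_assoc, swapOp_mul_self, mul_one]

end Ports

/-! ### Splitting off the last qubit -/

/-- The (unnormalised) state `⟨b|v` of the first `n` qubits left by projecting the last qubit of `v`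
onto `|b⟩`. -/
def slice (b : Fin 2) : QState (n + 1) →ₗ[ℂ] QState n where
  toFun v := WithLp.toLp 2 fun x => v (Fin.snoc (α := fun _ => Fin 2) x b)
  map_add' _ _ := rfl
  map_smul' _ _ := rfl

theorem slice_apply (b : Fin 2) (v : QState (n + 1)) (x : Fin n → Fin 2) :
    slice b v x = v (Fin.snoc (α := fun _ => Fin 2) x b) :=
  rfl

theorem ext_slice {v w : QState (n + 1)} (h : ∀ b, slice b v = slice b w) : v = w := by
  ext x
  rw [← Fin.snoc_init_self x, ← slice_apply, ← slice_apply, h]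

theorem inner_eq_sum_slice (v w : QState (n + 1)) :
    inner ℂ v w = ∑ b, inner ℂ (slice b v) (slice b w) := by
  simp only [PiLp.inner_apply, slice_apply]
  rw [← Fintype.sum_prod_type', ← (Fin.snocEquiv fun _ => Fin 2).sum_comp]
  rfl

theorem slice_qubitOp_castSucc (M : Matrix (Fin 2) (Fin 2) ℂ) (i : Fin n) (b : Fin 2)
    (v : QState (n + 1)) : slice b (qubitOp M i.castSucc v) = qubitOp M i (slice b v) := by
  ext x
  simp only [slice_apply, qubitOp_apply, Fin.snoc_castSucc, Fin.snoc_update]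

theorem slice_qubitOp_last (M : Matrix (Fin 2) (Fin 2) ℂ) (b : Fin 2) (v : QState (n + 1)) :
    slice b (qubitOp M (Fin.last n) v) = ∑ b', M b b' • slice b' v := by
  ext x
  simp only [slice_apply, qubitOp_apply, Fin.snoc_last, Fin.update_snoc_last]
  simp [slice_apply]

theorem slice_spinOp_map_castSucc (a : Finset (Fin n)) (c : Fin 3) (b : Fin 2)
    (v : QState (n + 1)) :
    slice b (spinOp (a.map Fin.castSuccEmb) c v) = spinOp a c (slice b v) := by
  simp only [spinOp, Finset.sum_map, Fin.coe_castSuccEmb, LinearMap.sum_apply, map_sum,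
    LinearMap.smul_apply, map_smul, slice_qubitOp_castSucc]

theorem slice_totalSpin_map_castSucc (a : Finset (Fin n)) (b : Fin 2) (v : QState (n + 1)) :
    slice b (totalSpin (a.map Fin.castSuccEmb) v) = totalSpin a (slice b v) := by
  simp only [totalSpin, LinearMap.sum_apply, map_sum, Module.End.mul_apply,
    slice_spinOp_map_castSucc]

theorem slice_spinOp_univ (c : Fin 3) (b : Fin 2) (v : QState (n + 1)) :
    slice b (spinOp Finset.univ c v) =
      spinOp Finset.univ c (slice b v) + (1 / 2 : ℂ) • ∑ b', pauli c b b' • slice b' v := by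
  rw [Fin.univ_castSuccEmb, Finset.cons_eq_insert, spinOp_insert (by simp), LinearMap.add_apply,
    map_add, slice_spinOp_map_castSucc, LinearMap.smul_apply, map_smul, slice_qubitOp_last,
    add_comm]

theorem slice_zSpin (b : Fin 2) (v : QState (n + 1)) :
    slice b (zSpin Finset.univ v) =
      zSpin Finset.univ (slice b v) + ((zBit b : ℂ) / 2) • slice b v := by
  rw [zSpin, slice_spinOp_univ, zSpin]
  fin_cases b <;> simp [pauli, zBit]
  module

/-! ### Ladder operators -/

/-- The raising operator `S₊ = S_x + i S_y` of all the qubits. -/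
def spinRaise (n : ℕ) : QOp n := spinOp Finset.univ 0 + Complex.I • spinOp Finset.univ 1

/-- The lowering operator `S₋ = S_x - i S_y` of all the qubits. -/
def spinLower (n : ℕ) : QOp n := spinOp Finset.univ 0 - Complex.I • spinOp Finset.univ 1

theorem inner_spinLower_right (v w : QState n) :
    inner ℂ v (spinLower n w) = inner ℂ (spinRaise n v) w := by
  simp only [spinLower, spinRaise, LinearMap.sub_apply, LinearMap.add_apply, LinearMap.smul_apply,
    inner_sub_right, inner_add_left, inner_smul_left, inner_smul_right, Complex.conj_I,
    spinOp_isSymmetric Finset.univ _ v w]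
  ring

theorem slice_spinRaise (b : Fin 2) (v : QState (n + 1)) :
    slice b (spinRaise (n + 1) v) =
      spinRaise n (slice b v) + if b = 0 then slice 1 v else 0 := by
  simp only [spinRaise, LinearMap.add_apply, LinearMap.smul_apply, map_add, map_smul,
    slice_spinOp_univ, Fin.sum_univ_two, pauli]
  fin_cases b
  · simp only [Fin.zero_eta, Matrix.cons_val_zero, Matrix.cons_val_one, Matrix.of_apply,
      Matrix.cons_val', Matrix.cons_val_fin_one, if_true]
    linear_combination (norm := module) ((-1 / 2 : ℂ) * Complex.I_sq) • slice 1 v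
  · simp only [Fin.mk_one, Matrix.cons_val_zero, Matrix.cons_val_one, Matrix.of_apply,
      Matrix.cons_val', Matrix.cons_val_fin_one, one_ne_zero, if_false]
    linear_combination (norm := module) ((1 / 2 : ℂ) * Complex.I_sq) • slice 0 v

theorem totalSpin_univ_eq (n : ℕ) :
    totalSpin (Finset.univ : Finset (Fin n)) =
      (1 / 2 : ℂ) • (spinRaise n * spinLower n + spinLower n * spinRaise n) +
        zSpin Finset.univ * zSpin Finset.univ := by
  simp only [totalSpin, Fin.sum_univ_three, spinRaise, spinLower, zSpin, mul_add, add_mul, mul_sub,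
    sub_mul, smul_mul_assoc, mul_smul_comm]
  match_scalars <;> ring_nf
  simp [Complex.I_sq]

/-! ### Clebsch-Gordan coefficients -/

/-- `z / 2` is a possible `Z`-spin for the spin `d / 2`. -/
abbrev IsZSpin (d : ℕ) (z : ℤ) : Prop := |z| ≤ (d : ℤ) ∧ Even (z + (d : ℤ))

/-- The matrix element `⟨j, m + 1| S₊ |j, m⟩`, with `d = 2j` and `z = 2m`. -/
def ladder (d : ℕ) (z : ℤ) : ℝ := √((d : ℝ) - z) * √((d : ℝ) + z + 2) / 2

theorem IsZSpin.le {d : ℕ} {z : ℤ} (hz : IsZSpin d z) : (z : ℝ) ≤ d := by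
  exact_mod_cast (abs_le.mp hz.1).2

theorem IsZSpin.neg_le {d : ℕ} {z : ℤ} (hz : IsZSpin d z) : -(d : ℝ) ≤ z := by
  exact_mod_cast (abs_le.mp hz.1).1

theorem ladder_mul_self {d : ℕ} {z : ℤ} (neg_le : -((d : ℤ) + 2) ≤ z) (le : z ≤ d) :
    ladder d z * ladder d z = ((d : ℝ) - z) * (d + z + 2) / 4 := by
  have neg_le : -((d : ℝ) + 2) ≤ z := by exact_mod_cast neg_le
  have le : (z : ℝ) ≤ d := by exact_mod_cast le
  rw [ladder, div_mul_div_comm, mul_mul_mul_comm, Real.mul_self_sqrt (by linarith),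
    Real.mul_self_sqrt (by linarith)]
  norm_num

theorem ladder_eq_zero {d : ℕ} {z : ℤ} (h : ¬(IsZSpin d z ↔ IsZSpin d (z + 2))) :
    ladder d z = 0 := by
  have hz : z = d ∨ z = -((d : ℤ) + 2) := by
    simp only [IsZSpin, abs_le, Int.even_iff] at h
    omega
  rcases hz with rfl | rfl <;> simp [ladder]

theorem cgHalf_up_zero (d : ℕ) (z : ℤ) :
    cgHalf d (d + 1) z 0 = √((d : ℝ) + 1 + z) / √(2 * ((d : ℝ) + 1)) := by
  rw [cgHalf, if_pos rfl, if_pos rfl, ← Real.sqrt_div' _ (by positivity)]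
  congr 1
  field_simp

theorem cgHalf_up_one (d : ℕ) (z : ℤ) :
    cgHalf d (d + 1) z 1 = √((d : ℝ) + 1 - z) / √(2 * ((d : ℝ) + 1)) := by
  rw [cgHalf, if_pos rfl, if_neg (by decide), ← Real.sqrt_div' _ (by positivity)]
  congr 1
  field_simp

theorem cgHalf_down_zero (d : ℕ) (z : ℤ) :
    cgHalf (d + 1) d z 0 = -(√((d : ℝ) + 2 - z) / √(2 * ((d : ℝ) + 2))) := by
  rw [cgHalf, if_neg (by omega), if_pos rfl, if_pos rfl, ← Real.sqrt_div' _ (by positivity)]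
  congr 2
  push_cast
  field_simp
  ring

theorem cgHalf_down_one (d : ℕ) (z : ℤ) :
    cgHalf (d + 1) d z 1 = √((d : ℝ) + 2 + z) / √(2 * ((d : ℝ) + 2)) := by
  rw [cgHalf, if_neg (by omega), if_pos rfl, if_neg (by decide),
    ← Real.sqrt_div' _ (by positivity)]
  congr 1
  push_cast
  field_simp
  ring

theorem cgHalf_eq_zero {d D : ℕ} (hD : D = d + 1 ∨ d = D + 1) {z : ℤ} {b : Fin 2}
    (h : ¬(IsZSpin D z ↔ IsZSpin d (z - zBit b))) : cgHalf d D z b = 0 := by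
  simp only [IsZSpin, abs_le, Int.even_iff] at h
  rcases hD with rfl | rfl <;> fin_cases b <;>
    simp only [Fin.zero_eta, Fin.mk_one, zBit, if_true, one_ne_zero, if_false] at h ⊢
  · obtain rfl : z = -((d : ℤ) + 1) := by omega
    simp [cgHalf_up_zero]
  · obtain rfl : z = (d : ℤ) + 1 := by omega
    simp [cgHalf_up_one]
  · obtain rfl : z = (D : ℤ) + 2 := by omega
    simp [cgHalf_down_zero]
  · obtain rfl : z = -((D : ℤ) + 2) := by omega
    simp [cgHalf_down_one]

theorem cgHalf_mul_ladder_sub {d D : ℕ} (hD : D = d + 1 ∨ d = D + 1) {z : ℤ} (hz : IsZSpin D z) :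
    cgHalf d D z 0 * ladder d (z - 1) + cgHalf d D z 1 =
      ladder D z * cgHalf d D (z + 2) 0 := by
  have le := hz.le
  have neg_le := hz.neg_le
  rcases hD with rfl | rfl
  · simp only [cgHalf_up_zero, cgHalf_up_one, ladder]
    push_cast at le neg_le ⊢
    rw [show (d : ℝ) - (z - 1) = d + 1 - z by ring, show (d : ℝ) + (z - 1) + 2 = d + 1 + z by ring,
      show (d : ℝ) + 1 + (z + 2) = d + 1 + z + 2 by ring]
    have sq_sqrt := Real.mul_self_sqrt (show 0 ≤ (d : ℝ) + 1 + z by linarith)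
    have sq_sqrt_shift := Real.mul_self_sqrt (show 0 ≤ (d : ℝ) + 1 + z + 2 by linarith)
    linear_combination (√((d : ℝ) + 1 - z) / √(2 * ((d : ℝ) + 1)) / 2) * (sq_sqrt - sq_sqrt_shift)
  · simp only [cgHalf_down_zero, cgHalf_down_one, ladder]
    push_cast
    rw [show (D : ℝ) + 1 - (z - 1) = D + 2 - z by ring,
      show (D : ℝ) + 1 + (z - 1) + 2 = D + 2 + z by ring,
      show (D : ℝ) + z + 2 = D + 2 + z by ring, show (D : ℝ) + 2 - (z + 2) = D - z by ring]
    have sq_sqrt := Real.mul_self_sqrt (show 0 ≤ (D : ℝ) + 2 - z by linarith)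
    have sq_sqrt_shift := Real.mul_self_sqrt (show 0 ≤ (D : ℝ) - z by linarith)
    linear_combination (√((D : ℝ) + 2 + z) / √(2 * ((D : ℝ) + 2)) / 2) * (sq_sqrt_shift - sq_sqrt)

theorem cgHalf_mul_ladder_add {d D : ℕ} (hD : D = d + 1 ∨ d = D + 1) (z : ℤ) :
    cgHalf d D z 1 * ladder d (z + 1) = ladder D z * cgHalf d D (z + 2) 1 := by
  rcases hD with rfl | rfl
  · simp only [cgHalf_up_one, ladder]
    push_cast
    ring_nf
  · simp only [cgHalf_down_one, ladder]
    push_cast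
    ring_nf

theorem cgHalf_sq_add_sq {d D : ℕ} (hD : D = d + 1 ∨ d = D + 1) {z : ℤ} (hz : IsZSpin D z) :
    cgHalf d D z 0 ^ 2 + cgHalf d D z 1 ^ 2 = 1 := by
  have le := hz.le
  have neg_le := hz.neg_le
  rcases hD with rfl | rfl
  · push_cast at le neg_le
    rw [cgHalf_up_zero, cgHalf_up_one, div_pow, div_pow, Real.sq_sqrt (by linarith),
      Real.sq_sqrt (by linarith), Real.sq_sqrt (by positivity)]
    field_simp
    ring
  · rw [cgHalf_down_zero, cgHalf_down_one, neg_sq, div_pow, div_pow, Real.sq_sqrt (by linarith),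
      Real.sq_sqrt (by positivity), Real.sq_sqrt (by linarith)]
    field_simp
    ring

theorem cgHalf_up_mul_down_add (d : ℕ) (z : ℤ) :
    cgHalf (d + 1) (d + 2) z 0 * cgHalf (d + 1) d z 0 +
      cgHalf (d + 1) (d + 2) z 1 * cgHalf (d + 1) d z 1 = 0 := by
  rw [cgHalf_up_zero, cgHalf_up_one, cgHalf_down_zero, cgHalf_down_one]
  push_cast
  ring_nf

theorem cgHalf_up_mul_down_sub (d : ℕ) {z : ℤ} (hz : |z| ≤ (d : ℤ) + 2) :
    cgHalf (d + 1) (d + 2) z 0 * cgHalf (d + 1) d z 1 -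
      cgHalf (d + 1) (d + 2) z 1 * cgHalf (d + 1) d z 0 = 1 := by
  have neg_le : -((d : ℝ) + 2) ≤ z := by exact_mod_cast (abs_le.mp hz).1
  have le : (z : ℝ) ≤ d + 2 := by exact_mod_cast (abs_le.mp hz).2
  rw [cgHalf_up_zero, cgHalf_up_one, cgHalf_down_zero, cgHalf_down_one, mul_neg, sub_neg_eq_add]
  push_cast
  rw [show (d : ℝ) + 1 + 1 = d + 2 by ring, div_mul_div_comm, div_mul_div_comm,
    Real.mul_self_sqrt (by linarith), Real.mul_self_sqrt (by linarith),
    Real.mul_self_sqrt (by positivity)]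
  field_simp
  ring

theorem sum_cgHalf_mul_cgHalf {d D D' : ℕ} (hD : D = d + 1 ∨ d = D + 1)
    (hD' : D' = d + 1 ∨ d = D' + 1) (z : ℤ) :
    (∑ b, if IsZSpin d (z - zBit b) then cgHalf d D z b * cgHalf d D' z b else 0) =
      if D = D' ∧ IsZSpin D z then 1 else 0 := by
  have drop_ite (h : IsZSpin D z ∨ IsZSpin D' z) (b : Fin 2) :
      (if IsZSpin d (z - zBit b) then cgHalf d D z b * cgHalf d D' z b else 0) =
        cgHalf d D z b * cgHalf d D' z b := by
    rw [ite_eq_left_iff]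
    intro hb
    rcases h with h | h
    · rw [cgHalf_eq_zero hD (by tauto), zero_mul]
    · rw [cgHalf_eq_zero hD' (by tauto), mul_zero]
  by_cases h : IsZSpin D z ∨ IsZSpin D' z
  · simp only [drop_ite h, Fin.sum_univ_two]
    by_cases hDD' : D = D'
    · subst hDD'
      rw [if_pos ⟨rfl, h.elim id id⟩, ← cgHalf_sq_add_sq hD (h.elim id id), sq, sq]
    · rw [if_neg fun h' => hDD' h'.1]
      rcases hD with rfl | rfl <;> rcases hD' with rfl | h'
      · exact absurd rfl hDD'
      · subst h'
        exact cgHalf_up_mul_down_add D' z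
      · linear_combination cgHalf_up_mul_down_add D z
      · omega
  · rw [if_neg fun h' => h (.inl h'.2)]
    refine Finset.sum_eq_zero fun b _ => ite_eq_right_iff.mpr fun hb => ?_
    rw [cgHalf_eq_zero hD (by tauto), zero_mul]

/-! ### Coupling the qubits one after the other -/

/-- The numbers `k 0, …, k n` are (the doubles of) possible total spins of the initial segments of
`n` qubits. The values of `k` beyond `n` are irrelevant. -/
def IsSpinPath (k : ℕ → ℕ) (n : ℕ) : Prop :=
  k 0 = 0 ∧ ∀ i < n, k (i + 1) = k i + 1 ∨ k i = k (i + 1) + 1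

theorem IsSpinPath.of_succ {k : ℕ → ℕ} (hk : IsSpinPath k (n + 1)) : IsSpinPath k n :=
  ⟨hk.1, fun i hi => hk.2 i (hi.trans n.lt_succ_self)⟩

theorem IsSpinPath.step {k : ℕ → ℕ} (hk : IsSpinPath k (n + 1)) :
    k (n + 1) = k n + 1 ∨ k n = k (n + 1) + 1 :=
  hk.2 n n.lt_succ_self

theorem IsSpinPath.update {k : ℕ → ℕ} (hk : IsSpinPath k n) {d : ℕ}
    (hd : d = k n + 1 ∨ k n = d + 1) : IsSpinPath (Function.update k (n + 1) d) (n + 1) := by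
  refine ⟨by simpa using hk.1, fun i hi => ?_⟩
  rcases (Nat.lt_succ_iff.mp hi).eq_or_lt with rfl | hi'
  · simpa using hd
  · rw [Function.update_of_ne (by omega), Function.update_of_ne (by omega)]
    exact hk.2 i hi'

theorem IsSpinPath.mem_spins {k : ℕ → ℕ} (hk : IsSpinPath k n) : k n ∈ spins n := by
  induction n with
  | zero => simp [spins, hk.1]
  | succ n ih =>
    have mem := ih hk.of_succ
    have step := hk.step
    simp only [spins, Finset.mem_filter, Finset.mem_range] at mem ⊢
    omega

/-- The state with spins `k` and `Z`-spin `z / 2` obtained by coupling `n` qubits one after the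
other; it is `0` if `z / 2` is not a possible `Z`-spin. -/
def schurVec (k : ℕ → ℕ) : (n : ℕ) → ℤ → QState n
  | 0, z => WithLp.toLp 2 fun _ => if z = 0 then 1 else 0
  | n + 1, z => WithLp.toLp 2 fun x =>
      (cgHalf (k n) (k (n + 1)) z (x (Fin.last n)) : ℂ) *
        schurVec k n (z - zBit (x (Fin.last n))) (Fin.init x)

theorem slice_schurVec (k : ℕ → ℕ) (z : ℤ) (b : Fin 2) :
    slice b (schurVec k (n + 1) z) =
      (cgHalf (k n) (k (n + 1)) z b : ℂ) • schurVec k n (z - zBit b) := by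
  ext x
  simp [slice_apply, schurVec]

theorem schurVec_congr {k k' : ℕ → ℕ} (h : ∀ i ≤ n, k i = k' i) (z : ℤ) :
    schurVec k n z = schurVec k' n z := by
  induction n generalizing z with
  | zero => rfl
  | succ n ih =>
    refine ext_slice fun b => ?_
    rw [slice_schurVec, slice_schurVec, ih fun i hi => h i (by omega), h n (by omega),
      h (n + 1) le_rfl]

theorem slice_schurVec_update (k : ℕ → ℕ) (d : ℕ) (z : ℤ) (b : Fin 2) :
    slice b (schurVec (Function.update k (n + 1) d) (n + 1) z) =
      (cgHalf (k n) d z b : ℂ) • schurVec k n (z - zBit b) := by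
  rw [slice_schurVec, Function.update_self, Function.update_of_ne (by omega),
    schurVec_congr fun i hi => Function.update_of_ne (by omega) _ _]

theorem schurVec_apply (k : ℕ → ℕ) (z : ℤ) (x : Fin n → Fin 2) :
    schurVec k n z x = if ∑ l, zBit (x l) = z then
      ((∏ i : Fin n, cgHalf (k i) (k (i + 1)) (∑ l ∈ Finset.Iic i, zBit (x l)) (x i) : ℝ) : ℂ)
      else 0 := by
  induction n generalizing z with
  | zero => simp [schurVec, eq_comm]
  | succ n ih =>
    have Iic_last : Finset.Iic (Fin.last n) = Finset.univ := by
      ext l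
      simp [Fin.le_last]
    rw [schurVec, PiLp.toLp_apply, ih, Fin.prod_univ_castSucc]
    simp only [Fin.sum_Iic_castSucc, Fin.val_castSucc, Fin.val_last, Iic_last,
      Fin.sum_univ_castSucc, eq_sub_iff_add_eq, Fin.init]
    split_ifs with h
    · rw [h, Complex.ofReal_mul, mul_comm]
    · rw [mul_zero]

theorem inner_schurVec {k k' : ℕ → ℕ} (hk : IsSpinPath k n) (hk' : IsSpinPath k' n) (z z' : ℤ) :
    inner ℂ (schurVec k n z) (schurVec k' n z') =
      if ((∀ i ≤ n, k i = k' i) ∧ z = z') ∧ IsZSpin (k n) z then 1 else 0 := by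
  induction n generalizing z z' with
  | zero =>
    have inner_eq : inner ℂ (schurVec k 0 z) (schurVec k' 0 z') =
        if z = 0 ∧ z' = 0 then (1 : ℂ) else 0 := by
      simp [PiLp.inner_apply, schurVec, ite_and]
    have iff_zero : z = 0 ∧ z' = 0 ↔ ((∀ i ≤ 0, k i = k' i) ∧ z = z') ∧ IsZSpin (k 0) z := by
      simp only [Nat.le_zero, forall_eq, hk.1, hk'.1, true_and, IsZSpin, abs_le, Int.even_iff]
      omega
    rw [inner_eq, if_congr iff_zero rfl rfl]
  | succ n ih =>
    have agree_succ : (∀ i ≤ n + 1, k i = k' i) ↔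
        (∀ i ≤ n, k i = k' i) ∧ k (n + 1) = k' (n + 1) := by
      simp only [← Nat.lt_succ_iff, Nat.forall_lt_succ_right]
    simp only [inner_eq_sum_slice, slice_schurVec, inner_smul_left, inner_smul_right,
      Complex.conj_ofReal, ih hk.of_succ hk'.of_succ, sub_left_inj, agree_succ]
    by_cases agree : (∀ i ≤ n, k i = k' i) ∧ z = z'
    · obtain ⟨agree, rfl⟩ := agree
      have step' := hk'.step
      rw [← agree n le_rfl] at step' ⊢
      simpa [eq_true agree, apply_ite Complex.ofReal, mul_comm] using
        congrArg Complex.ofReal (sum_cgHalf_mul_cgHalf hk.step step' z)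
    · have not_agree : ¬((((∀ i ≤ n, k i = k' i) ∧ k (n + 1) = k' (n + 1)) ∧ z = z') ∧
          IsZSpin (k (n + 1)) z) := fun h => agree ⟨h.1.1.1, h.1.2⟩
      simp [agree, not_agree]

theorem schurVec_eq_zero {k : ℕ → ℕ} (hk : IsSpinPath k n) {z : ℤ} (hz : ¬IsZSpin (k n) z) :
    schurVec k n z = 0 := by
  rw [← inner_self_eq_zero (𝕜 := ℂ), inner_schurVec hk hk, if_neg fun h => hz h.2]

theorem eq_zero_of_sum_cgHalf_mul_eq_zero {d : ℕ} {z : ℤ} {b : Fin 2} {a : Fin 2 → ℂ}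
    (hz : IsZSpin d (z - zBit b))
    (h : ∀ D, (D = d + 1 ∨ d = D + 1) → ∑ b', (cgHalf d D z b' : ℂ) * a b' = 0) : a b = 0 := by
  simp only [Fin.sum_univ_two] at h
  rcases d with _ | d
  · obtain rfl : z = zBit b := by simpa [IsZSpin, sub_eq_zero] using hz.1
    have up := h 1 (.inl rfl)
    fin_cases b <;> simpa [cgHalf, zBit] using up
  · have abs_le : |z| ≤ (d : ℤ) + 2 := by
      have abs_sub_le := abs_le.mp hz.1
      rw [abs_le]
      fin_cases b <;> simp [zBit] at abs_sub_le <;> omega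
    have up := h (d + 2) (.inl rfl)
    have down := h d (.inr rfl)
    have det := congrArg Complex.ofReal (cgHalf_up_mul_down_sub d abs_le)
    push_cast at det
    fin_cases b
    · change a 0 = 0
      linear_combination (cgHalf (d + 1) d z 1 : ℂ) * up -
        (cgHalf (d + 1) (d + 2) z 1 : ℂ) * down - a 0 * det
    · change a 1 = 0
      linear_combination (cgHalf (d + 1) (d + 2) z 0 : ℂ) * down -
        (cgHalf (d + 1) d z 0 : ℂ) * up - a 1 * det

theorem eq_zero_of_inner_schurVec_eq_zero {v : QState n}
    (hv : ∀ k z, IsSpinPath k n → inner ℂ (schurVec k n z) v = 0) : v = 0 := by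
  induction n with
  | zero =>
    ext x
    have inner_eq := hv (fun _ => 0) 0 ⟨rfl, by simp⟩
    simpa [PiLp.inner_apply, schurVec, Unique.eq_default] using inner_eq
  | succ n ih =>
    refine ext_slice fun b => (map_zero (slice b)).symm ▸ ih fun k z hk => ?_
    by_cases hz : IsZSpin (k n) z
    · rw [← add_sub_cancel_right z (zBit b)] at hz ⊢
      refine eq_zero_of_sum_cgHalf_mul_eq_zero hz
        (a := fun b' => inner ℂ (schurVec k n (z + zBit b - zBit b')) (slice b' v))
        fun D hD => ?_
      simpa only [inner_eq_sum_slice, slice_schurVec_update, inner_smul_left, Complex.conj_ofReal]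
        using hv _ (z + zBit b) (hk.update hD)
    · rw [schurVec_eq_zero hk hz, inner_zero_left]

theorem span_schurVec (n : ℕ) :
    Submodule.span ℂ {v | ∃ k z, IsSpinPath k n ∧ IsZSpin (k n) z ∧ schurVec k n z = v} = ⊤ := by
  rw [← Submodule.orthogonal_eq_bot_iff, Submodule.eq_bot_iff]
  intro v hv
  refine eq_zero_of_inner_schurVec_eq_zero fun k z hk => ?_
  by_cases hz : IsZSpin (k n) z
  · exact hv _ (Submodule.subset_span ⟨k, z, hk, hz, rfl⟩)
  · rw [schurVec_eq_zero hk hz, inner_zero_left]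

theorem ext_schurVec {T T' : QOp n}
    (h : ∀ k z, IsSpinPath k n → IsZSpin (k n) z → T (schurVec k n z) = T' (schurVec k n z)) :
    T = T' := by
  refine LinearMap.ext_on (span_schurVec n) ?_
  rintro _ ⟨k, z, hk, hz, rfl⟩
  exact h k z hk hz

theorem ext_inner_schurVec {v w : QState n}
    (h : ∀ k z, IsSpinPath k n → IsZSpin (k n) z →
      inner ℂ (schurVec k n z) v = inner ℂ (schurVec k n z) w) : v = w := by
  refine sub_eq_zero.mp (eq_zero_of_inner_schurVec_eq_zero fun k z hk => ?_)
  by_cases hz : IsZSpin (k n) z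
  · rw [inner_sub_right, h k z hk hz, sub_self]
  · rw [schurVec_eq_zero hk hz, inner_zero_left]

/-! ### The action of the angular momenta -/

theorem zSpin_schurVec (k : ℕ → ℕ) (n : ℕ) (z : ℤ) :
    zSpin Finset.univ (schurVec k n z) = ((z : ℂ) / 2) • schurVec k n z := by
  induction n generalizing z with
  | zero =>
    ext x
    by_cases hz : z = 0 <;> simp [schurVec, zSpin, spinOp, hz]
  | succ n ih =>
    refine ext_slice fun b => ?_
    rw [slice_zSpin, map_smul, slice_schurVec, map_smul, ih]
    push_cast
    module

theorem ladder_smul_schurVec_of_not_isZSpin {k : ℕ → ℕ} (hk : IsSpinPath k n) {z : ℤ}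
    (hz : ¬IsZSpin (k n) z) : (ladder (k n) z : ℂ) • schurVec k n (z + 2) = 0 := by
  by_cases hz' : IsZSpin (k n) (z + 2)
  · rw [ladder_eq_zero (by tauto), Complex.ofReal_zero, zero_smul]
  · rw [schurVec_eq_zero hk hz', smul_zero]

theorem spinRaise_schurVec {k : ℕ → ℕ} (hk : IsSpinPath k n) (z : ℤ) :
    spinRaise n (schurVec k n z) = (ladder (k n) z : ℂ) • schurVec k n (z + 2) := by
  induction n generalizing z with
  | zero =>
    ext x
    by_cases hz : z + 2 = 0
    · simp [spinRaise, spinOp, ladder, hk.1, eq_neg_of_add_eq_zero_left hz]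
    · simp [spinRaise, spinOp, schurVec, hz]
  | succ n ih =>
    by_cases hz : IsZSpin (k (n + 1)) z
    · refine ext_slice fun b => ?_
      rw [slice_spinRaise, map_smul, slice_schurVec, slice_schurVec, slice_schurVec, map_smul,
        ih hk.of_succ]
      fin_cases b
      · have raise := congrArg Complex.ofReal (cgHalf_mul_ladder_sub hk.step hz)
        push_cast at raise
        simp only [Fin.zero_eta, zBit, if_true, one_ne_zero, if_false, smul_smul]
        rw [show z - 1 + 2 = z - -1 by ring, show z + 2 - 1 = z - -1 by ring, ← raise, add_smul]
      · have raise := congrArg Complex.ofReal (cgHalf_mul_ladder_add hk.step z)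
        push_cast at raise
        simp only [Fin.mk_one, zBit, one_ne_zero, if_false, smul_smul, sub_neg_eq_add, add_zero]
        rw [show z + 1 + 2 = z + 2 + 1 by ring, raise]
    · rw [ladder_smul_schurVec_of_not_isZSpin hk hz, schurVec_eq_zero hk hz, map_zero]

theorem spinLower_schurVec {k : ℕ → ℕ} (hk : IsSpinPath k n) (z : ℤ) :
    spinLower n (schurVec k n z) = (ladder (k n) (z - 2) : ℂ) • schurVec k n (z - 2) := by
  refine ext_inner_schurVec fun k' z' hk' hz' => ?_
  rw [inner_spinLower_right, spinRaise_schurVec hk', inner_smul_left, inner_smul_right,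
    inner_schurVec hk' hk, inner_schurVec hk' hk, Complex.conj_ofReal]
  by_cases same : (∀ i ≤ n, k' i = k i) ∧ z' = z - 2
  · obtain ⟨agree, rfl⟩ := same
    rw [sub_add_cancel, agree n le_rfl] at *
    by_cases hz : IsZSpin (k n) z
    · rw [if_pos ⟨⟨agree, rfl⟩, hz⟩, if_pos ⟨⟨agree, rfl⟩, hz'⟩]
    · rw [ladder_eq_zero (by rw [sub_add_cancel]; tauto), Complex.ofReal_zero, zero_mul, zero_mul]
  · rw [if_neg fun h => same ⟨h.1.1, eq_sub_of_add_eq h.1.2⟩, if_neg fun h => same h.1, mul_zero,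
      mul_zero]

theorem totalSpin_univ_schurVec {k : ℕ → ℕ} (hk : IsSpinPath k n) (z : ℤ) :
    totalSpin Finset.univ (schurVec k n z) =
      ((k n : ℂ) / 2 * ((k n : ℂ) / 2 + 1)) • schurVec k n z := by
  by_cases hz : IsZSpin (k n) z
  · obtain ⟨neg_le, le⟩ := abs_le.mp hz.1
    have raise_mul_self := congrArg Complex.ofReal
      (ladder_mul_self (d := k n) (z := z) (by omega) le)
    have lower_mul_self := congrArg Complex.ofReal
      (ladder_mul_self (d := k n) (z := z - 2) (by omega) (by omega))
    push_cast at raise_mul_self lower_mul_self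
    simp only [totalSpin_univ_eq, LinearMap.add_apply, LinearMap.smul_apply, Module.End.mul_apply,
      spinRaise_schurVec hk, spinLower_schurVec hk, zSpin_schurVec, map_smul, smul_smul,
      sub_add_cancel, add_sub_cancel_right, raise_mul_self, lower_mul_self]
    module
  · rw [schurVec_eq_zero hk hz, map_zero, smul_zero]

theorem totalSpin_initial_schurVec {k : ℕ → ℕ} (hk : IsSpinPath k n) (z : ℤ) {i : ℕ}
    (hi : i ≤ n) :
    totalSpin (Finset.univ.filter fun q : Fin n => (q : ℕ) < i) (schurVec k n z) =
      ((k i : ℂ) / 2 * ((k i : ℂ) / 2 + 1)) • schurVec k n z := by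
  induction n generalizing z with
  | zero =>
    obtain rfl := Nat.le_zero.mp hi
    rw [Subsingleton.elim (Finset.univ.filter _) Finset.univ, totalSpin_univ_schurVec hk]
  | succ n ih =>
    rcases hi.eq_or_lt with rfl | hlt
    · rw [Finset.filter_true_of_mem fun q _ => q.2, totalSpin_univ_schurVec hk]
    · have filter_eq_map : (Finset.univ.filter fun q : Fin (n + 1) => (q : ℕ) < i) =
          (Finset.univ.filter fun q : Fin n => (q : ℕ) < i).map Fin.castSuccEmb := by
        ext q
        induction q using Fin.lastCases <;> simp
        omega
      refine ext_slice fun b => ?_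
      rw [filter_eq_map, slice_totalSpin_map_castSucc, map_smul, slice_schurVec, map_smul,
        ih hk.of_succ _ (Nat.lt_succ_iff.mp hlt), smul_comm]

/-! ### The singlet on the last two qubits -/

theorem cCoef_up (j : ℕ) : cCoef (j + 1) j (j + 1) = √((j : ℝ) + 1) / √(2 * ((j : ℝ) + 2)) := by
  rw [cCoef, if_pos ⟨rfl, rfl⟩, ← Real.sqrt_div' _ (by positivity)]
  congr 1
  push_cast
  field_simp
  ring

theorem cCoef_down (s : ℕ) : cCoef s (s + 1) s = -(√((s : ℝ) + 2) / √(2 * ((s : ℝ) + 1))) := by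
  rw [cCoef, if_neg (by omega), if_pos ⟨rfl, rfl⟩, ← Real.sqrt_div' _ (by positivity)]
  congr 2
  field_simp

theorem cCoef_eq_zero {k j s : ℕ} (h : ¬(k = s ∧ (s = j + 1 ∨ j = s + 1))) : cCoef k j s = 0 := by
  rw [cCoef, if_neg (by omega), if_neg (by omega)]

theorem cgHalf_up_mul_down_antisymm (j : ℕ) {z : ℤ} (hz : |z| ≤ (j : ℤ) + 1) :
    cgHalf j (j + 1) z 1 * cgHalf (j + 1) j (z + 1) 0 -
      cgHalf j (j + 1) z 0 * cgHalf (j + 1) j (z - 1) 1 = -(√2 * cCoef (j + 1) j (j + 1)) := by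
  have neg_le : -((j : ℝ) + 1) ≤ z := by exact_mod_cast (abs_le.mp hz).1
  have le : (z : ℝ) ≤ j + 1 := by exact_mod_cast (abs_le.mp hz).2
  have sq_add : √((j : ℝ) + 1 + z) ^ 2 = j + 1 + z := Real.sq_sqrt (by linarith)
  have sq_sub : √((j : ℝ) + 1 - z) ^ 2 = j + 1 - z := Real.sq_sqrt (by linarith)
  have sq_norm : √((j : ℝ) + 1) ^ 2 = j + 1 := Real.sq_sqrt (by positivity)
  rw [cCoef_up, cgHalf_up_zero, cgHalf_up_one, cgHalf_down_zero, cgHalf_down_one]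
  push_cast
  rw [show (j : ℝ) + 2 - (z + 1) = j + 1 - z by ring,
    show (j : ℝ) + 2 + (z - 1) = j + 1 + z by ring, Real.sqrt_mul zero_le_two,
    Real.sqrt_mul zero_le_two]
  field_simp
  rw [Real.sq_sqrt zero_le_two]
  linear_combination -sq_add - sq_sub + 2 * sq_norm

theorem cgHalf_down_mul_up_antisymm (s : ℕ) {z : ℤ} (hz : |z| ≤ (s : ℤ)) :
    cgHalf (s + 1) s z 1 * cgHalf s (s + 1) (z + 1) 0 -
      cgHalf (s + 1) s z 0 * cgHalf s (s + 1) (z - 1) 1 = -(√2 * cCoef s (s + 1) s) := by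
  have neg_le : -(s : ℝ) ≤ z := by exact_mod_cast (abs_le.mp hz).1
  have le : (z : ℝ) ≤ s := by exact_mod_cast (abs_le.mp hz).2
  have sq_add : √((s : ℝ) + 2 + z) ^ 2 = s + 2 + z := Real.sq_sqrt (by linarith)
  have sq_sub : √((s : ℝ) + 2 - z) ^ 2 = s + 2 - z := Real.sq_sqrt (by linarith)
  have sq_norm : √((s : ℝ) + 2) ^ 2 = s + 2 := Real.sq_sqrt (by positivity)
  rw [cCoef_down, cgHalf_up_zero, cgHalf_up_one, cgHalf_down_zero, cgHalf_down_one]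
  push_cast
  rw [show (s : ℝ) + 1 + (z + 1) = s + 2 + z by ring,
    show (s : ℝ) + 1 - (z - 1) = s + 2 - z by ring, Real.sqrt_mul zero_le_two,
    Real.sqrt_mul zero_le_two]
  field_simp
  rw [Real.sq_sqrt zero_le_two]
  linear_combination sq_add + sq_sub - 2 * sq_norm

theorem cgHalf_mul_cgHalf_antisymm {k j s : ℕ} (hj : j = k + 1 ∨ k = j + 1)
    (hs : s = j + 1 ∨ j = s + 1) {z : ℤ} (hz : |z| ≤ (s : ℤ)) :
    cgHalf j s z 1 * cgHalf k j (z + 1) 0 - cgHalf j s z 0 * cgHalf k j (z - 1) 1 =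
      -(√2 * cCoef k j s) := by
  rcases hs with rfl | rfl <;> rcases hj with hj | rfl
  · subst hj
    rw [cCoef_eq_zero (by omega), cgHalf_up_zero, cgHalf_up_one, cgHalf_up_zero, cgHalf_up_one]
    push_cast
    ring_nf
  · exact cgHalf_up_mul_down_antisymm j (mod_cast hz)
  · obtain rfl : s = k := by omega
    exact cgHalf_down_mul_up_antisymm s hz
  · rw [cCoef_eq_zero (by omega), cgHalf_down_zero, cgHalf_down_one, cgHalf_down_zero,
      cgHalf_down_one]
    push_cast
    ring_nf

/-- The (unnormalised) state `⟨ψ⁻|v` of the first `n` qubits left by projecting the last two qubits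
of `v` onto the singlet. -/
def singletComp : QState (n + 2) →ₗ[ℂ] QState n :=
  ((√2 : ℝ) : ℂ)⁻¹ • (slice 0 ∘ₗ slice 1 - slice 1 ∘ₗ slice 0)

theorem slice_slice_singletProj (b b' : Fin 2) (v : QState (n + 2)) :
    slice b (slice b' (singletProj (Fin.last n).castSucc (Fin.last (n + 1)) v)) =
      singlet b b' • singletComp v := by
  ext x
  simp only [slice_apply, singletComp, singletProj_apply (Fin.castSucc_lt_last _).ne,
    LinearMap.smul_apply, LinearMap.sub_apply, LinearMap.comp_apply, PiLp.smul_apply,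
    PiLp.sub_apply, ← Fin.snoc_update, Fin.update_snoc_last, Fin.snoc_last, Fin.snoc_castSucc,
    smul_eq_mul]

theorem inner_singletProj_right (v w : QState (n + 2)) :
    inner ℂ v (singletProj (Fin.last n).castSucc (Fin.last (n + 1)) w) =
      inner ℂ (singletComp v) (singletComp w) := by
  rw [inner_eq_sum_slice]
  simp only [inner_eq_sum_slice (n := n), Fin.sum_univ_two, slice_slice_singletProj,
    inner_smul_right]
  generalize singletComp w = w'
  simp only [singletComp, LinearMap.smul_apply, LinearMap.sub_apply, LinearMap.comp_apply,
    inner_smul_left, inner_sub_left, ← Complex.ofReal_inv, Complex.conj_ofReal]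
  simp [singlet]
  ring

theorem singletComp_schurVec {k : ℕ → ℕ} (hk : IsSpinPath k (n + 2)) (z : ℤ) :
    singletComp (schurVec k (n + 2) z) =
      (-cCoef (k n) (k (n + 1)) (k (n + 2)) : ℂ) • schurVec k n z := by
  by_cases hz : IsZSpin (k (n + 2)) z
  · have antisymm := congrArg Complex.ofReal
      (cgHalf_mul_cgHalf_antisymm hk.of_succ.step hk.step hz.1)
    have sqrt_two_ne_zero : ((√2 : ℝ) : ℂ) ≠ 0 := by simp
    push_cast at antisymm
    simp only [singletComp, LinearMap.smul_apply, LinearMap.sub_apply, LinearMap.comp_apply,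
      slice_schurVec, map_smul, smul_smul, zBit, if_true, one_ne_zero, if_false, sub_neg_eq_add,
      add_sub_cancel_right, sub_add_cancel, ← sub_smul, antisymm]
    congr 1
    field_simp
  · rw [schurVec_eq_zero hk hz, map_zero]
    by_cases h : k n = k (n + 2)
    · rw [schurVec_eq_zero hk.of_succ.of_succ (h ▸ hz), smul_zero]
    · rw [cCoef_eq_zero (by tauto), Complex.ofReal_zero, neg_zero, zero_smul]

theorem singletProj_schurVec_of_ne {k : ℕ → ℕ} (hk : IsSpinPath k (n + 2)) (z : ℤ)
    (hne : k n ≠ k (n + 2)) :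
    singletProj (Fin.last n).castSucc (Fin.last (n + 1)) (schurVec k (n + 2) z) = 0 := by
  refine ext_slice fun b => ext_slice fun b' => ?_
  rw [slice_slice_singletProj, singletComp_schurVec hk, cCoef_eq_zero (by tauto)]
  simp

theorem IsSpinPath.update_penultimate {k : ℕ → ℕ} (hk : IsSpinPath k (n + 2))
    (h : k n = k (n + 2)) {j : ℕ} (hj : j = k n + 1 ∨ k n = j + 1) :
    IsSpinPath (Function.update k (n + 1) j) (n + 2) := by
  have update_path := hk.of_succ.of_succ.update hj
  refine ⟨update_path.1, fun i hi => ?_⟩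
  rcases (Nat.lt_succ_iff.mp hi).eq_or_lt with rfl | hi'
  · rw [Function.update_self, Function.update_of_ne (by omega), ← h]
    exact hj.symm
  · exact update_path.2 i hi'

theorem inner_schurVec_update {k k' : ℕ → ℕ} (hk : IsSpinPath k (n + 2))
    (hk' : IsSpinPath k' (n + 2)) (h : k n = k (n + 2)) {j : ℕ} (hj : j = k n + 1 ∨ k n = j + 1)
    (z z' : ℤ) :
    inner ℂ (schurVec k' (n + 2) z') (schurVec (Function.update k (n + 1) j) (n + 2) z) =
      if k' (n + 1) = j ∧ k' (n + 2) = k n then inner ℂ (schurVec k' n z') (schurVec k n z)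
      else 0 := by
  have agree_iff : (∀ i ≤ n + 2, k' i = Function.update k (n + 1) j i) ↔
      (∀ i ≤ n, k' i = k i) ∧ k' (n + 1) = j ∧ k' (n + 2) = k n := by
    simp only [← Nat.lt_succ_iff, Nat.forall_lt_succ_right (n := n + 2),
      Nat.forall_lt_succ_right (n := n + 1), and_assoc, Function.update_self, h]
    refine and_congr (forall₂_congr fun i hi => ?_) (by simp)
    rw [Function.update_of_ne (by omega)]
  rw [inner_schurVec hk' (hk.update_penultimate h hj),
    inner_schurVec hk'.of_succ.of_succ hk.of_succ.of_succ, ← ite_and]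
  refine if_congr ?_ rfl rfl
  rw [agree_iff]
  constructor
  · rintro ⟨⟨⟨agree, hj', hs⟩, rfl⟩, hz⟩
    exact ⟨⟨hj', hs⟩, ⟨agree, rfl⟩, by rwa [agree n le_rfl, ← hs]⟩
  · rintro ⟨⟨hj', hs⟩, ⟨agree, rfl⟩, hz⟩
    exact ⟨⟨⟨agree, hj', hs⟩, rfl⟩, by rwa [hs, ← agree n le_rfl]⟩

theorem singletProj_schurVec {k : ℕ → ℕ} (hk : IsSpinPath k (n + 2)) (z : ℤ)
    (h : k n = k (n + 2)) :
    singletProj (Fin.last n).castSucc (Fin.last (n + 1)) (schurVec k (n + 2) z) =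
      (cCoef (k n) (k (n + 1)) (k n) : ℂ) •
        ((cCoef (k n) (k n - 1) (k n) : ℂ) •
            schurVec (Function.update k (n + 1) (k n - 1)) (n + 2) z +
          (cCoef (k n) (k n + 1) (k n) : ℂ) •
            schurVec (Function.update k (n + 1) (k n + 1)) (n + 2) z) := by
  refine ext_inner_schurVec (n := n + 2) fun k' z' hk' _ => ?_
  have inner_update (j : ℕ) : (cCoef (k n) j (k n) : ℂ) *
      inner ℂ (schurVec k' (n + 2) z') (schurVec (Function.update k (n + 1) j) (n + 2) z) =
      if k' (n + 1) = j ∧ k' (n + 2) = k n then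
        (cCoef (k n) j (k n) : ℂ) * inner ℂ (schurVec k' n z') (schurVec k n z) else 0 := by
    by_cases hj : j = k n + 1 ∨ k n = j + 1
    · rw [inner_schurVec_update hk hk' h hj, mul_ite, mul_zero]
    · rw [cCoef_eq_zero (by tauto)]
      simp
  rw [inner_singletProj_right, singletComp_schurVec hk', singletComp_schurVec hk, inner_smul_right,
    inner_smul_left, inner_smul_right, inner_add_right, inner_smul_right, inner_smul_right,
    inner_update, inner_update, ← h]
  by_cases agree : ∀ i ≤ n, k' i = k i
  · have step := hk'.of_succ.step
    rw [agree n le_rfl] at step ⊢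
    by_cases hs : k' (n + 2) = k n
    · rw [hs]
      rcases step with hj | hj
      · rw [if_neg (by omega), if_pos ⟨hj, rfl⟩, hj]
        simp
      · rw [if_pos (by omega), if_neg (by omega), show k' (n + 1) = k n - 1 by omega]
        simp
    · simp [hs, cCoef_eq_zero fun h' => hs h'.1.symm]
  · have inner_eq_zero : inner ℂ (schurVec k' n z') (schurVec k n z) = 0 := by
      rw [inner_schurVec hk'.of_succ.of_succ hk.of_succ.of_succ, if_neg fun h' => agree h'.1.1]
    simp [inner_eq_zero]

/-! ### The measurement operators on the Schur states -/

theorem hCoef_pos (N : ℕ) : 0 < hCoef N := by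
  unfold hCoef
  positivity

theorem gCoef_pos (N d : ℕ) : 0 < gCoef N d := by
  unfold gCoef
  positivity

theorem nu_pos (N d : ℕ) : 0 < nu N d :=
  div_pos (mul_pos (mul_pos (by positivity) (hCoef_pos N)) (by positivity)) (gCoef_pos N d)

theorem sqrt_nu_ne_zero (N d : ℕ) : ((√(nu N d) : ℝ) : ℂ) ≠ 0 :=
  Complex.ofReal_ne_zero.mpr (Real.sqrt_pos.mpr (nu_pos N d)).ne'

theorem uCoef_pos {N : ℕ} (hN : 1 ≤ N) (d : ℕ) : 0 < uCoef N d :=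
  div_pos (mul_pos (mul_pos (by positivity) (hCoef_pos N)) (by positivity))
    (mul_pos (by exact_mod_cast hN) (gCoef_pos (N - 1) d))

theorem gam_zero (N : ℕ) : gam N 0 = 0 := by
  rw [gam, cCoef_eq_zero (by omega), zero_div]

theorem del_ne_zero (N d : ℕ) : del N d ≠ 0 := by
  rw [del, cCoef_down]
  exact div_ne_zero (neg_ne_zero.mpr (by positivity)) (Real.sqrt_pos.mpr (nu_pos _ _)).ne'

theorem gam_sq_add_del_sq_pos (N d : ℕ) : 0 < gam N d ^ 2 + del N d ^ 2 :=
  add_pos_of_nonneg_of_pos (sq_nonneg _) (sq_pos_of_ne_zero (del_ne_zero N d))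

theorem ports_eq_filter (N : ℕ) :
    ports N = Finset.univ.filter fun q : Fin (N + 1) => (q : ℕ) < N := by
  ext q
  simp [ports, ← Fin.lt_last_iff_ne_last, Fin.lt_def]

theorem ports_erase_last (n : ℕ) : (ports (n + 1)).erase (Fin.last n).castSucc =
    Finset.univ.filter fun q : Fin (n + 2) => (q : ℕ) < n := by
  ext q
  simp only [ports_eq_filter, Finset.mem_erase, Finset.mem_filter, Finset.mem_univ, true_and, ne_eq,
    Fin.ext_iff, Fin.val_last, Fin.val_castSucc]
  omega

theorem opO_schurVec {k : ℕ → ℕ} (hk : IsSpinPath k (n + 1)) (z : ℤ) :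
    opO n (schurVec k (n + 1) z) = ((√(nu n (k n)) : ℝ) : ℂ) • schurVec k (n + 1) z := by
  rw [opO, ports_eq_filter, sum_smul_spinProj_apply (totalSpin_initial_schurVec hk z n.le_succ),
    if_pos hk.of_succ.mem_spins]

theorem isUnit_opO (n : ℕ) : IsUnit (opO n) := by
  rw [LinearMap.isUnit_iff_range_eq_top, eq_top_iff, ← span_schurVec, Submodule.span_le]
  rintro _ ⟨k, z, hk, -, rfl⟩
  refine ⟨((√(nu n (k n)) : ℝ) : ℂ)⁻¹ • schurVec k (n + 1) z, ?_⟩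
  rw [map_smul, opO_schurVec hk, inv_smul_smul₀ (sqrt_nu_ne_zero _ _)]

theorem ringInverse_apply_of_apply_eq_smul {K V : Type*} [Field K] [AddCommGroup V] [Module K V]
    {T : Module.End K V} (hT : IsUnit T) {c : K} (hc : c ≠ 0) {v : V} (hv : T v = c • v) :
    Ring.inverse T v = c⁻¹ • v := by
  rw [eq_inv_smul_iff₀ hc, ← map_smul, ← hv, ← Module.End.mul_apply, Ring.inverse_mul_cancel _ hT,
    Module.End.one_apply]

theorem ringInverse_opO_schurVec {k : ℕ → ℕ} (hk : IsSpinPath k (n + 1)) (z : ℤ) :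
    Ring.inverse (opO n) (schurVec k (n + 1) z) =
      ((√(nu n (k n)) : ℝ) : ℂ)⁻¹ • schurVec k (n + 1) z :=
  ringInverse_apply_of_apply_eq_smul (isUnit_opO n) (sqrt_nu_ne_zero _ _) (opO_schurVec hk z)

theorem opTheta_last_schurVec {k : ℕ → ℕ} (hk : IsSpinPath k (n + 2)) (z : ℤ) :
    opTheta (n + 1) (Fin.last n) (schurVec k (n + 2) z) =
      (uCoef (n + 1) (k n) : ℂ) • schurVec k (n + 2) z := by
  rw [opTheta, ports_erase_last, Nat.add_sub_cancel,
    sum_smul_spinProj_apply (totalSpin_initial_schurVec hk z (by omega)),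
    if_pos hk.of_succ.of_succ.mem_spins]

theorem povm_last_schurVec_eq_smul {k : ℕ → ℕ} (hk : IsSpinPath k (n + 2)) (z : ℤ) :
    povm (n + 1) (Fin.last n) (schurVec k (n + 2) z) =
      ((√(nu (n + 1) (k (n + 1))) : ℂ)⁻¹ * uCoef (n + 1) (k n)) • Ring.inverse (opO (n + 1))
        (singletProj (Fin.last n).castSucc (Fin.last (n + 1)) (schurVec k (n + 2) z)) := by
  simp only [povm, Module.End.mul_apply, ringInverse_opO_schurVec hk, opTheta_last_schurVec hk,
    map_smul, smul_smul]

theorem povm_last_schurVec_of_ne {k : ℕ → ℕ} (hk : IsSpinPath k (n + 2)) (z : ℤ)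
    (hne : k n ≠ k (n + 2)) : povm (n + 1) (Fin.last n) (schurVec k (n + 2) z) = 0 := by
  rw [povm_last_schurVec_eq_smul hk, singletProj_schurVec_of_ne hk z hne, map_zero, smul_zero]

theorem povm_last_schurVec {k : ℕ → ℕ} (hk : IsSpinPath k (n + 2)) (z : ℤ)
    (h : k n = k (n + 2)) :
    povm (n + 1) (Fin.last n) (schurVec k (n + 2) z) =
      (uCoef (n + 1) (k n) *
          (cCoef (k n) (k (n + 1)) (k n) / √(nu (n + 1) (k (n + 1))) : ℝ) : ℂ) •
        ((gam (n + 1) (k n) : ℂ) • schurVec (Function.update k (n + 1) (k n - 1)) (n + 2) z +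
          (del (n + 1) (k n) : ℂ) • schurVec (Function.update k (n + 1) (k n + 1)) (n + 2) z) := by
  have inverse_update (j : ℕ) :
      (cCoef (k n) j (k n) : ℂ) • Ring.inverse (opO (n + 1))
          (schurVec (Function.update k (n + 1) j) (n + 2) z) =
        ((cCoef (k n) j (k n) / √(nu (n + 1) j) : ℝ) : ℂ) •
          schurVec (Function.update k (n + 1) j) (n + 2) z := by
    by_cases hj : j = k n + 1 ∨ k n = j + 1
    · rw [ringInverse_opO_schurVec (hk.update_penultimate h hj), Function.update_self, smul_smul,
        Complex.ofReal_div, div_eq_mul_inv]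
    · rw [cCoef_eq_zero (by tauto)]
      simp
  rw [povm_last_schurVec_eq_smul hk, singletProj_schurVec hk z h, map_smul, map_add, map_smul,
    map_smul, inverse_update, inverse_update, gam, del, smul_smul]
  congr 1
  push_cast
  ring

/-! ### The failure operator -/

theorem singletProj_last_mul_opTheta_last (n : ℕ) :
    singletProj (Fin.last n).castSucc (Fin.last (n + 1)) * opTheta (n + 1) (Fin.last n) =
      singletProj (Fin.last n).castSucc (Fin.last (n + 1)) *
        ∑ d ∈ spins n, (uCoef (n + 1) d : ℂ) • spinProj Finset.univ d := by
  refine ext_schurVec (n := n + 2) fun k z hk _ => ?_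
  rw [Module.End.mul_apply, Module.End.mul_apply, opTheta_last_schurVec hk,
    sum_smul_spinProj_apply (totalSpin_univ_schurVec hk z)]
  by_cases h : k n = k (n + 2)
  · rw [← h, if_pos hk.of_succ.of_succ.mem_spins]
  · rw [apply_ite (singletProj _ _), map_smul, map_smul, map_zero,
      singletProj_schurVec_of_ne hk z h, smul_zero, smul_zero, ite_self]

theorem singletProj_last_mul_opTheta (i : Fin (n + 1)) :
    singletProj i.castSucc (Fin.last (n + 1)) * opTheta (n + 1) i =
      singletProj i.castSucc (Fin.last (n + 1)) *
        ∑ d ∈ spins n, (uCoef (n + 1) d : ℂ) • spinProj Finset.univ d := by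
  have semiconj_univ := semiconjBy_swapOp_sum_smul_spinProj i.castSucc (Fin.last n).castSucc
    Finset.univ (spins n) fun d => (uCoef (n + 1) d : ℂ)
  rw [Finset.map_univ_equiv] at semiconj_univ
  have semiconj_singlet := semiconjBy_swapOp_singletProj_last i (Fin.last n)
  have semiconj_theta := (semiconj_singlet.mul_right (semiconjBy_swapOp_opTheta i (Fin.last n))).eq
  rw [singletProj_last_mul_opTheta_last,
    (semiconj_singlet.mul_right semiconj_univ).eq] at semiconj_theta
  have isUnit_swapOp : IsUnit (swapOp i.castSucc (Fin.last n).castSucc) :=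
    .of_mul_eq_one _ (swapOp_mul_self _ _)
  exact (isUnit_swapOp.mul_right_cancel semiconj_theta).symm

theorem sum_singletProj_schurVec {k : ℕ → ℕ} (hk : IsSpinPath k (n + 2)) (z : ℤ) :
    (∑ i : Fin (n + 1), singletProj i.castSucc (Fin.last (n + 1))) (schurVec k (n + 2) z) =
      ((2 ^ n * lam (n + 1) (k (n + 1)) (k (n + 2)) : ℝ) : ℂ) • schurVec k (n + 2) z := by
  rw [sum_singletProj_ports, LinearMap.sub_apply, LinearMap.smul_apply, LinearMap.smul_apply,
    LinearMap.sub_apply, totalSpin_univ_schurVec hk, ports_eq_filter,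
    totalSpin_initial_schurVec hk z (by omega), Module.End.one_apply, ← sub_smul, smul_smul,
    ← sub_smul]
  congr 1
  have step : k (n + 2) = k (n + 1) + 1 ∨ k (n + 1) = k (n + 2) + 1 := hk.step
  rcases step with h | h
  · rw [lam, if_pos h, h]
    push_cast
    field_simp
    ring
  · rw [lam, if_neg (by omega), if_pos h, h]
    push_cast
    field_simp
    ring

theorem sum_povm (n : ℕ) : ∑ i : Fin (n + 1), povm (n + 1) i = Ring.inverse (opO (n + 1)) *
    ((∑ i : Fin (n + 1), singletProj i.castSucc (Fin.last (n + 1))) *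
      ∑ d ∈ spins n, (uCoef (n + 1) d : ℂ) • spinProj Finset.univ d) *
        Ring.inverse (opO (n + 1)) := by
  simp only [povm, singletProj_last_mul_opTheta, ← Finset.sum_mul, ← Finset.mul_sum]

theorem povmFail_schurVec {k : ℕ → ℕ} (hk : IsSpinPath k (n + 2)) (z : ℤ) :
    povmFail (n + 1) (schurVec k (n + 2) z) =
      ((1 - (if k (n + 2) ∈ spins n then 2 ^ n * lam (n + 1) (k (n + 1)) (k (n + 2)) *
        uCoef (n + 1) (k (n + 2)) / nu (n + 1) (k (n + 1)) else 0) : ℝ) : ℂ) •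
        schurVec k (n + 2) z := by
  have inv_sqrt_mul_self : ((√(nu (n + 1) (k (n + 1))) : ℝ) : ℂ)⁻¹ *
      ((√(nu (n + 1) (k (n + 1))) : ℝ) : ℂ)⁻¹ = ((nu (n + 1) (k (n + 1)) : ℝ) : ℂ)⁻¹ := by
    rw [← mul_inv, ← Complex.ofReal_mul, Real.mul_self_sqrt (nu_pos _ _).le]
  rw [povmFail, sum_povm, LinearMap.sub_apply, Module.End.one_apply, Module.End.mul_apply,
    Module.End.mul_apply, Module.End.mul_apply, ringInverse_opO_schurVec hk, map_smul,
    sum_smul_spinProj_apply (totalSpin_univ_schurVec hk z)]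
  split_ifs
  · simp only [map_smul, sum_singletProj_schurVec hk, ringInverse_opO_schurVec hk]
    match_scalars
    linear_combination (-(uCoef (n + 1) (k (n + 2)) : ℂ) * 2 ^ n *
      (lam (n + 1) (k (n + 1)) (k (n + 2)) : ℂ)) * inv_sqrt_mul_self
  · simp

/-! ### Schur labels as spin paths -/

/-- The spins of a label as a sequence, extended by `0`, so that a Schur state is one of the vectors
`schurVec`. -/
def SchurLabel.path (ℓ : SchurLabel n) (i : ℕ) : ℕ := if h : i < n + 1 then ℓ.spin ⟨i, h⟩ else 0

namespace SchurLabel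

theorem path_eq_spin (ℓ : SchurLabel n) {i : ℕ} (h : i < n + 1) : ℓ.path i = ℓ.spin ⟨i, h⟩ :=
  dif_pos h

theorem isSpinPath (ℓ : SchurLabel n) : IsSpinPath ℓ.path n := by
  refine ⟨(ℓ.path_eq_spin (by omega)).trans ℓ.spin_zero, fun i hi => ?_⟩
  rw [ℓ.path_eq_spin (by omega), ℓ.path_eq_spin (by omega)]
  exact ℓ.spin_step ⟨i, hi⟩

theorem isZSpin (ℓ : SchurLabel n) : IsZSpin (ℓ.path n) ℓ.z := by
  rw [ℓ.path_eq_spin (by omega)]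
  exact ⟨ℓ.abs_z_le, ℓ.even_z⟩

theorem ext_path {ℓ ℓ' : SchurLabel n} (h : ∀ i ≤ n, ℓ.path i = ℓ'.path i) (hz : ℓ.z = ℓ'.z) :
    ℓ = ℓ' := by
  have spin_eq : ℓ.spin = ℓ'.spin := by
    funext i
    rw [← ℓ.path_eq_spin i.2, ← ℓ'.path_eq_spin i.2, h i (by omega)]
  cases ℓ
  cases ℓ'
  simp_all

theorem path_eq_kSpin (ℓ : SchurLabel (n + 2)) : ℓ.path n = kSpin (N := n + 1) ℓ :=
  ℓ.path_eq_spin (by omega)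

theorem path_eq_jSpin (ℓ : SchurLabel (n + 2)) : ℓ.path (n + 1) = jSpin (N := n + 1) ℓ :=
  ℓ.path_eq_spin (by omega)

theorem path_eq_sSpin (ℓ : SchurLabel (n + 2)) : ℓ.path (n + 2) = sSpin (N := n + 1) ℓ :=
  ℓ.path_eq_spin (by omega)

end SchurLabel

theorem schurState_eq_schurVec (ℓ : SchurLabel n) : schurState ℓ = schurVec ℓ.path n ℓ.z := by
  ext x
  have path_eq (i : Fin n) : ℓ.path i = ℓ.spin i.castSucc ∧ ℓ.path (i + 1) = ℓ.spin i.succ :=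
    ⟨ℓ.path_eq_spin _, ℓ.path_eq_spin _⟩
  simp only [schurVec_apply, schurState, path_eq]

theorem orthonormal_schurState (n : ℕ) :
    Orthonormal ℂ (schurState : SchurLabel n → QState n) := by
  classical
  refine orthonormal_iff_ite.mpr fun ℓ ℓ' => ?_
  rw [schurState_eq_schurVec, schurState_eq_schurVec, inner_schurVec ℓ.isSpinPath ℓ'.isSpinPath]
  refine if_congr ⟨fun h => SchurLabel.ext_path h.1.1 h.1.2, ?_⟩ rfl rfl
  rintro rfl
  exact ⟨⟨fun _ _ => rfl, rfl⟩, ℓ.isZSpin⟩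

theorem span_schurState (n : ℕ) :
    Submodule.span ℂ (Set.range (schurState : SchurLabel n → QState n)) = ⊤ := by
  rw [eq_top_iff, ← span_schurVec n]
  refine Submodule.span_mono ?_
  rintro _ ⟨k, z, hk, hz, rfl⟩
  let ℓ : SchurLabel n :=
    { spin := fun i => k i
      spin_zero := hk.1
      spin_step := fun i => hk.2 i i.2
      z := z
      abs_z_le := hz.1
      even_z := hz.2 }
  exact ⟨ℓ, (schurState_eq_schurVec ℓ).trans
    (schurVec_congr (fun i hi => ℓ.path_eq_spin (by omega)) z)⟩

theorem totalSpin_initial_schurState (ℓ : SchurLabel n) (i : Fin (n + 1)) :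
    totalSpin (Finset.univ.filter fun q : Fin n => (q : ℕ) < (i : ℕ)) (schurState ℓ) =
      ((ℓ.spin i : ℂ) / 2 * ((ℓ.spin i : ℂ) / 2 + 1)) • schurState ℓ := by
  rw [schurState_eq_schurVec, totalSpin_initial_schurVec ℓ.isSpinPath _ (by omega),
    ℓ.path_eq_spin i.2]

theorem zSpin_schurState (ℓ : SchurLabel n) :
    zSpin Finset.univ (schurState ℓ) = ((ℓ.z : ℂ) / 2) • schurState ℓ := by
  rw [schurState_eq_schurVec, zSpin_schurVec]

theorem hasEigenvector_schurState {T : QOp n} {μ : ℂ} {ℓ : SchurLabel n}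
    (h : T (schurVec ℓ.path n ℓ.z) = μ • schurVec ℓ.path n ℓ.z) :
    Module.End.HasEigenvector T μ (schurState ℓ) := by
  rw [Module.End.hasEigenvector_iff, Module.End.mem_eigenspace_iff, schurState_eq_schurVec]
  exact ⟨h, schurState_eq_schurVec ℓ ▸ (orthonormal_schurState n).ne_zero ℓ⟩

/-! ### Eigenvectors of the measurement operators -/

theorem hasEigenvector_of_rank_one {K E : Type*} [Field K] [AddCommGroup E] [Module K E]
    {T : Module.End K E} {e f : E} {a b c r : K} (linearIndependent : LinearIndependent K ![e, f])
    (he : T e = (c * a) • (a • e + b • f)) (hf : T f = (c * b) • (a • e + b • f))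
    (hb : b ≠ 0) (hr : r ≠ 0) :
    Module.End.HasEigenvector T 0 ((b / r) • e - (a / r) • f) ∧
      Module.End.HasEigenvector T (c * (a ^ 2 + b ^ 2)) ((a / r) • e + (b / r) • f) := by
  rw [LinearIndependent.pair_iff] at linearIndependent
  have quotient_ne_zero : b / r ≠ 0 := div_ne_zero hb hr
  rw [Module.End.hasEigenvector_iff, Module.End.mem_eigenspace_iff, Module.End.hasEigenvector_iff,
    Module.End.mem_eigenspace_iff, map_sub, map_add, map_smul, map_smul, map_smul, map_smul, he, hf]
  refine ⟨⟨by module, fun h => ?_⟩, by module, fun h => ?_⟩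
  · rw [sub_eq_add_neg, ← neg_smul] at h
    exact quotient_ne_zero (linearIndependent _ _ h).1
  · exact quotient_ne_zero (linearIndependent _ _ h).2

theorem hasEigenvector_conj_iff {R E : Type*} [CommRing R] [AddCommGroup E] [Module R E]
    {T T' W : Module.End R E} (hW : W * W = 1) (hT : T' = W * T * W) (μ : R) (v : E) :
    Module.End.HasEigenvector T μ v ↔ Module.End.HasEigenvector T' μ (W v) := by
  have involutive (w : E) : W (W w) = w := LinearMap.congr_fun hW w
  have injective : Function.Injective W := Function.LeftInverse.injective involutive
  rw [Module.End.hasEigenvector_iff, Module.End.mem_eigenspace_iff, Module.End.hasEigenvector_iff,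
    Module.End.mem_eigenspace_iff, hT, Module.End.mul_apply, Module.End.mul_apply, involutive,
    ← map_smul, injective.eq_iff, ne_eq, ne_eq, map_eq_zero_iff W injective]

theorem povm_last_hasEigenvector_of_ne {ℓ : SchurLabel (n + 1 + 1)} (h : ℓ.kSpin ≠ ℓ.sSpin) :
    Module.End.HasEigenvector (povm (n + 1) (Fin.last n)) 0 (schurState ℓ) := by
  rw [← ℓ.path_eq_kSpin, ← ℓ.path_eq_sSpin] at h
  refine hasEigenvector_schurState ?_
  rw [zero_smul, povm_last_schurVec_of_ne ℓ.isSpinPath ℓ.z h]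

theorem schurVec_update_path {ℓ ℓ' : SchurLabel (n + 1 + 1)}
    (h : ∀ i : Fin (n + 3), (i : ℕ) ≠ n + 1 → ℓ.spin i = ℓ'.spin i) (hz : ℓ.z = ℓ'.z) :
    schurVec (Function.update ℓ.path (n + 1) ℓ'.jSpin) (n + 2) ℓ.z = schurState ℓ' := by
  rw [schurState_eq_schurVec, ← hz]
  refine schurVec_congr (fun i hi => ?_) _
  rcases eq_or_ne i (n + 1) with rfl | hne
  · rw [Function.update_self, ℓ'.path_eq_jSpin]
  · rw [Function.update_of_ne hne, ℓ.path_eq_spin (by omega), ℓ'.path_eq_spin (by omega)]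
    exact h ⟨i, by omega⟩ hne

theorem povm_last_schurState {ℓ ℓ₁ ℓ₂ : SchurLabel (n + 1 + 1)} {s : ℕ}
    (h₁ : ∀ i : Fin (n + 3), (i : ℕ) ≠ n + 1 → ℓ.spin i = ℓ₁.spin i) (hz₁ : ℓ.z = ℓ₁.z)
    (h₂ : ∀ i : Fin (n + 3), (i : ℕ) ≠ n + 1 → ℓ.spin i = ℓ₂.spin i) (hz₂ : ℓ.z = ℓ₂.z)
    (hk : ℓ.kSpin = s) (hs : ℓ.sSpin = s) (hj₁ : ℓ₁.jSpin = s - 1) (hj₂ : ℓ₂.jSpin = s + 1) :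
    povm (n + 1) (Fin.last n) (schurState ℓ) =
      ((uCoef (n + 1) s : ℂ) * ((cCoef s ℓ.jSpin s / √(nu (n + 1) ℓ.jSpin) : ℝ) : ℂ)) •
        ((gam (n + 1) s : ℂ) • schurState ℓ₁ + (del (n + 1) s : ℂ) • schurState ℓ₂) := by
  rw [← schurVec_update_path h₁ hz₁, ← schurVec_update_path h₂ hz₂, hj₁, hj₂,
    schurState_eq_schurVec]
  rw [← ℓ.path_eq_kSpin] at hk
  rw [← ℓ.path_eq_sSpin] at hs
  rw [povm_last_schurVec ℓ.isSpinPath ℓ.z (hk.trans hs.symm), hk, ℓ.path_eq_jSpin]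

theorem povm_last_hasEigenvector_pair {ℓ₁ ℓ₂ : SchurLabel (n + 1 + 1)} {s : ℕ}
    (h : ∀ i : Fin (n + 3), (i : ℕ) ≠ n + 1 → ℓ₁.spin i = ℓ₂.spin i) (hz : ℓ₁.z = ℓ₂.z)
    (hk : ℓ₁.kSpin = s) (hs : ℓ₁.sSpin = s) (hj₁ : s = ℓ₁.jSpin + 1) (hj₂ : ℓ₂.jSpin = s + 1) :
    Module.End.HasEigenvector (povm (n + 1) (Fin.last n)) 0
        (((del (n + 1) s / √(gam (n + 1) s ^ 2 + del (n + 1) s ^ 2) : ℝ) : ℂ) • schurState ℓ₁ -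
          ((gam (n + 1) s / √(gam (n + 1) s ^ 2 + del (n + 1) s ^ 2) : ℝ) : ℂ) • schurState ℓ₂) ∧
      Module.End.HasEigenvector (povm (n + 1) (Fin.last n))
        ((uCoef (n + 1) s * (gam (n + 1) s ^ 2 + del (n + 1) s ^ 2) : ℝ) : ℂ)
        (((gam (n + 1) s / √(gam (n + 1) s ^ 2 + del (n + 1) s ^ 2) : ℝ) : ℂ) • schurState ℓ₁ +
          ((del (n + 1) s / √(gam (n + 1) s ^ 2 + del (n + 1) s ^ 2) : ℝ) : ℂ) •
            schurState ℓ₂) := by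
  have jSpin_eq : ℓ₁.jSpin = s - 1 := by omega
  have povm_left := povm_last_schurState (fun _ _ => rfl) rfl h hz hk hs jSpin_eq hj₂
  have povm_right := povm_last_schurState (fun i hi => (h i hi).symm) hz.symm (fun _ _ => rfl) rfl
    ((h ⟨n, by omega⟩ (by simp)).symm.trans hk) ((h (Fin.last _) (by simp)).symm.trans hs)
    jSpin_eq hj₂
  rw [jSpin_eq, ← gam] at povm_left
  rw [hj₂, ← del] at povm_right
  have ne : ℓ₁ ≠ ℓ₂ := by
    rintro rfl
    omega
  have linearIndependent : LinearIndependent ℂ ![schurState ℓ₁, schurState ℓ₂] := by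
    have schurState_comp : ![schurState ℓ₁, schurState ℓ₂] = schurState ∘ ![ℓ₁, ℓ₂] :=
      FinVec.map_eq schurState ![ℓ₁, ℓ₂]
    rw [schurState_comp]
    exact (orthonormal_schurState _).linearIndependent.comp _ (by simpa using ne)
  push_cast
  refine hasEigenvector_of_rank_one linearIndependent povm_left povm_right
    (Complex.ofReal_ne_zero.mpr (del_ne_zero _ _)) ?_
  exact Complex.ofReal_ne_zero.mpr (Real.sqrt_pos.mpr (gam_sq_add_del_sq_pos _ _)).ne'

theorem povm_last_hasEigenvector_zero {ℓ : SchurLabel (n + 1 + 1)} (hk : ℓ.kSpin = 0)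
    (hs : ℓ.sSpin = 0) : Module.End.HasEigenvector (povm (n + 1) (Fin.last n))
      ((uCoef (n + 1) 0 * (gam (n + 1) 0 ^ 2 + del (n + 1) 0 ^ 2) : ℝ) : ℂ) (schurState ℓ) := by
  rw [← ℓ.path_eq_kSpin] at hk
  rw [← ℓ.path_eq_sSpin] at hs
  have path_eq_one : ℓ.path (n + 1) = 1 := by
    have step : ℓ.path (n + 2) = ℓ.path (n + 1) + 1 ∨ ℓ.path (n + 1) = ℓ.path (n + 2) + 1 :=
      ℓ.isSpinPath.step
    omega
  have update_eq : Function.update ℓ.path (n + 1) 1 = ℓ.path :=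
    Function.update_eq_self_iff.mpr path_eq_one.symm
  refine hasEigenvector_schurState ?_
  rw [povm_last_schurVec ℓ.isSpinPath ℓ.z (hk.trans hs.symm), hk, path_eq_one, zero_add,
    update_eq, gam_zero, del]
  module

theorem povmFail_hasEigenvector {ℓ : SchurLabel (n + 1 + 1)} (h : ℓ.sSpin ≠ n + 2) :
    Module.End.HasEigenvector (povmFail (n + 1)) ((1 - 2 ^ n * lam (n + 1) ℓ.jSpin ℓ.sSpin *
      uCoef (n + 1) ℓ.sSpin / nu (n + 1) ℓ.jSpin : ℝ) : ℂ) (schurState ℓ) := by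
  rw [← ℓ.path_eq_sSpin] at h ⊢
  rw [← ℓ.path_eq_jSpin]
  have mem_spins : ℓ.path (n + 2) ∈ spins n := by
    have mem_spins_succ : ℓ.path (n + 2) ∈ spins (n + 2) := ℓ.isSpinPath.mem_spins
    simp only [spins, Finset.mem_filter, Finset.mem_range] at mem_spins_succ ⊢
    omega
  refine hasEigenvector_schurState ?_
  rw [povmFail_schurVec ℓ.isSpinPath, if_pos mem_spins]

theorem povmFail_hasEigenvector_one {ℓ : SchurLabel (n + 1 + 1)} (h : ℓ.sSpin = n + 2) :
    Module.End.HasEigenvector (povmFail (n + 1)) 1 (schurState ℓ) := by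
  rw [← ℓ.path_eq_sSpin] at h
  have notMem_spins : ℓ.path (n + 2) ∉ spins n := by
    simp only [spins, Finset.mem_filter, Finset.mem_range]
    omega
  refine hasEigenvector_schurState ?_
  rw [povmFail_schurVec ℓ.isSpinPath, if_neg notMem_spins, sub_zero, Complex.ofReal_one]

end PBT

end

theorem mainTheorem3 (N : ℕ) (hN : 1 ≤ N) :
    -- the Schur states are an orthonormal basis with the spins given by their labels
    (Orthonormal ℂ (schurState : SchurLabel (N + 1) → QState (N + 1)) ∧
      Submodule.span ℂ (Set.range (schurState : SchurLabel (N + 1) → QState (N + 1))) = ⊤ ∧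
      ∀ ℓ : SchurLabel (N + 1),
        (∀ i : Fin (N + 2),
          totalSpin (Finset.univ.filter fun q : Fin (N + 1) => (q : ℕ) < (i : ℕ)) (schurState ℓ) =
            ((ℓ.spin i : ℂ) / 2 * ((ℓ.spin i : ℂ) / 2 + 1)) • schurState ℓ) ∧
        zSpin Finset.univ (schurState ℓ) = ((ℓ.z : ℂ) / 2) • schurState ℓ) ∧
    IsUnit (opO N) ∧
    -- `Π_N` annihilates the Schur states whose spin on the first `N - 1` qubits is not `s`
    (∀ ℓ : SchurLabel (N + 1), ℓ.kSpin ≠ ℓ.sSpin →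
      Module.End.HasEigenvector (povm N ⟨N - 1, by omega⟩) 0 (schurState ℓ)) ∧
    -- the pairs of Schur states that differ only in the spin `j = s ∓ 1/2` of the ports
    (∀ ℓ₁ ℓ₂ : SchurLabel (N + 1), ∀ s : ℕ,
      (∀ i : Fin (N + 2), (i : ℕ) ≠ N → ℓ₁.spin i = ℓ₂.spin i) → ℓ₁.z = ℓ₂.z →
      ℓ₁.kSpin = s → ℓ₁.sSpin = s → s = ℓ₁.jSpin + 1 → ℓ₂.jSpin = s + 1 →
      Module.End.HasEigenvector (povm N ⟨N - 1, by omega⟩) 0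
        (((del N s / √(gam N s ^ 2 + del N s ^ 2) : ℝ) : ℂ) • schurState ℓ₁ -
          ((gam N s / √(gam N s ^ 2 + del N s ^ 2) : ℝ) : ℂ) • schurState ℓ₂) ∧
      Module.End.HasEigenvector (povm N ⟨N - 1, by omega⟩)
        ((uCoef N s * (gam N s ^ 2 + del N s ^ 2) : ℝ) : ℂ)
        (((gam N s / √(gam N s ^ 2 + del N s ^ 2) : ℝ) : ℂ) • schurState ℓ₁ +
          ((del N s / √(gam N s ^ 2 + del N s ^ 2) : ℝ) : ℂ) • schurState ℓ₂)) ∧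
    -- for `s = 0` only the state with `j = 1/2` exists
    (∀ ℓ : SchurLabel (N + 1), ℓ.kSpin = 0 → ℓ.sSpin = 0 →
      Module.End.HasEigenvector (povm N ⟨N - 1, by omega⟩)
        ((uCoef N 0 * (gam N 0 ^ 2 + del N 0 ^ 2) : ℝ) : ℂ) (schurState ℓ)) ∧
    (∀ s ∈ spins (N - 1), 0 < uCoef N s * (gam N s ^ 2 + del N s ^ 2)) ∧
    -- the other `Π_i` are conjugate to `Π_N` by exchanging two ports
    (∀ i : Fin N,
      povm N i = swapOp i.castSucc (Fin.castSucc ⟨N - 1, by omega⟩) * povm N ⟨N - 1, by omega⟩ *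
        swapOp i.castSucc (Fin.castSucc ⟨N - 1, by omega⟩) ∧
      ∀ (μ : ℂ) (v : QState (N + 1)),
        Module.End.HasEigenvector (povm N ⟨N - 1, by omega⟩) μ v ↔
          Module.End.HasEigenvector (povm N i) μ
            (swapOp i.castSucc (Fin.castSucc ⟨N - 1, by omega⟩) v)) ∧
    -- `Π_{N+1}` is diagonal in the Schur basis; `u(s)` is only defined for `s ≤ (N - 1) / 2`, and
    -- `λ(j, s) = 0` for the states of maximal spin `s = (N + 1) / 2`
    (∀ ℓ : SchurLabel (N + 1), ℓ.sSpin ≠ N + 1 →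
      Module.End.HasEigenvector (povmFail N)
        ((1 - 2 ^ (N - 1) * lam N ℓ.jSpin ℓ.sSpin * uCoef N ℓ.sSpin / nu N ℓ.jSpin : ℝ) : ℂ)
        (schurState ℓ)) ∧
    (∀ ℓ : SchurLabel (N + 1), ℓ.sSpin = N + 1 →
      Module.End.HasEigenvector (povmFail N) 1 (schurState ℓ)) := by
  obtain ⟨n, rfl⟩ : ∃ n, N = n + 1 := ⟨N - 1, by omega⟩
  exact ⟨⟨orthonormal_schurState _, span_schurState _, fun ℓ =>
      ⟨totalSpin_initial_schurState ℓ, zSpin_schurState ℓ⟩⟩,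
    isUnit_opO _,
    fun _ => povm_last_hasEigenvector_of_ne,
    fun _ _ _ => povm_last_hasEigenvector_pair,
    fun _ => povm_last_hasEigenvector_zero,
    fun s _ => mul_pos (uCoef_pos hN s) (gam_sq_add_del_sq_pos _ _),
    fun i => ⟨povm_eq_swapOp_conj i (Fin.last n),
      hasEigenvector_conj_iff (swapOp_mul_self _ _) (povm_eq_swapOp_conj i (Fin.last n))⟩,
    fun _ => povmFail_hasEigenvector,
    fun _ => povmFail_hasEigenvector_one⟩
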